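/- \textbf{Conventions.} A ReLU network with input in $\mathbb{R}^d$ and scalar output is a function $f = T_L\circ\sigma\circ T_{L-1}\circ\cdots\circ\sigma\circ T_1$ with $L\ge 2$, where each $T_l:\mathbb{R}^{N_{l-1}}\to\mathbb{R}^{N_l}$ is affine ($N_0=d$, $N_L=1$) and $\sigma(t)=\max\{0,t\}$ acts coordinatewise. Its depth is $L$ and its width is $\max\{N_1,\dots,N_{L-1}\}$; empty hidden layers are allowed, so a network of width $0$ is a constant function. "A network with width $N$ and depth $L$" means one with width at most $N$ and depth at most $L$. For $\varphi:\mathbb{R}^d\to\mathbb{R}$ continuous with compact support put $\|\varphi\|_\infty=\sup_{x\in\mathbb{R}^d}|\varphi(x)|$ and $$C_\varphi := \#\{n\in\mathbb{Z}^d : \varphi(x-n)\ne 0 \text{ for some } x\in[0,1)^d\}.$$ For an integer $j$ and $M>0$ let $\mathcal{S}_j(\varphi,M)$ be the set of all functions $g(x)=\sum_{n\in\mathbb{Z}^d}c_n\,\varphi(2^jx-n)$ in which only finitely many $c_n$ are non-zero and $|c_n|<M$ for every $n$. \textbf{Theorem (Uniform approximation).} Let $d,j\ge 1$ be integers, $0<\epsilon<1$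 and $M>0$. Let $\varphi:\mathbb{R}^d\to\mathbb{R}$ be continuous with compact support, and suppose that there is a ReLU network $\phi_0$ with width $N_\varphi(\epsilon)$ and depth $L_\varphi(\epsilon)$ such that $|\varphi(x)-\phi_0(x)|\le\epsilon\|\varphi\|_\infty$ for all $x\in\mathbb{R}^d$. Then for every $g\in\mathcal{S}_j(\varphi,M)$ and all integers $r,s,\tilde r,\tilde s\ge 1$ with $2(s+r)\ge dj$ and $\tilde r\tilde s\ge\lceil\log_2(1/\epsilon)\rceil+1$ there is a ReLU network $\phi$ with width $3^d\cdot 2C_\varphi\bigl(\max\{7d\tilde r2^r,N_\varphi(\epsilon)\}+4d\bigr)$ and depth $14\tilde s2^s+L_\varphi(\epsilon)+2d$ such that $$|g(x)-\phi(x)|\le 6C_\varphi M\|\varphi\|_\infty\,\epsilon\qquad\text{for all }x\in[0,1]^d.$$ -/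

import Mathlib

/-- A fully connected feed-forward ReLU network with output dimension `m` and input dimension `n`:
either a single affine map (the last layer), or an affine map into a hidden layer with `k` neurons,
followed by the activation and the rest of the network. -/
inductive ReLUNet (m : ℕ) : ℕ → Type where
  | output {n : ℕ} (A : Matrix (Fin m) (Fin n) ℝ) (b : Fin m → ℝ) : ReLUNet m n
  | hidden {n k : ℕ} (A : Matrix (Fin k) (Fin n) ℝ) (b : Fin k → ℝ) (rest : ReLUNet m k) :
      ReLUNet m n

namespace ReLUNet

/-- The function `T_L ∘ σ ∘ T_{L-1} ∘ ⋯ ∘ σ ∘ T_1` with `σ t = max 0 t` acting coordinatewise. -/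
def eval {m : ℕ} : {n : ℕ} → ReLUNet m n → (Fin n → ℝ) → (Fin m → ℝ)
  | _, output A b, x => A.mulVec x + b
  | _, hidden A b rest, x => rest.eval (fun i => max 0 ((A.mulVec x + b) i))

/-- The depth `L`: the number of affine maps. -/
def depth {m : ℕ} : {n : ℕ} → ReLUNet m n → ℕ
  | _, output _ _ => 1
  | _, hidden _ _ rest => rest.depth + 1

/-- The width: the largest size of a hidden layer. -/
def width {m : ℕ} : {n : ℕ} → ReLUNet m n → ℕ
  | _, output _ _ => 0
  | _, hidden (k := k) _ _ rest => max k rest.width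

end ReLUNet

/-- The class of functions `ℝ^d → ℝ` represented by ReLU networks of width at most `N` and depth at
most `L`, where a network has depth at least `2`. Hidden layers may be empty, which matters only for
`N = 0`: then the class consists of the constant functions (if `2 ≤ L`). -/
def ReLUClass (d N L : ℕ) : Set ((Fin d → ℝ) → ℝ) :=
  {f | ∃ net : ReLUNet 1 d, 2 ≤ net.depth ∧ net.depth ≤ L ∧ net.width ≤ N ∧
    ∀ x, f x = net.eval x 0}

/-- The sup norm of a bounded function on `ℝ^d`. -/
noncomputable def supNorm {d : ℕ} (f : (Fin d → ℝ) → ℝ) : ℝ := ⨆ x, |f x|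

/-- The functions `x ↦ ∑ n, c n * φ (2 ^ j * x - n)` with finitely supported coefficients
`c : ℤ^d → ℝ` satisfying `|c n| < M`. -/
def dilatedShiftSpace {d : ℕ} (φ : (Fin d → ℝ) → ℝ) (j : ℕ) (M : ℝ) : Set ((Fin d → ℝ) → ℝ) :=
  {g | ∃ c : (Fin d → ℤ) →₀ ℝ, (∀ n, |c n| < M) ∧
    ∀ x, g x = c.sum fun n a => a * φ (fun i => 2 ^ j * x i - (n i : ℝ))}

/-- The integer vectors `n` such that `φ (x - n) ≠ 0` for some `x ∈ [0,1)^d`. -/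
def activeShifts {d : ℕ} (φ : (Fin d → ℝ) → ℝ) : Set (Fin d → ℤ) :=
  {n | ∃ x : Fin d → ℝ, (∀ i, x i ∈ Set.Ico (0 : ℝ) 1) ∧ φ (fun i => x i - (n i : ℝ)) ≠ 0}

/-- The number of active shifts; it is finite when `φ` has compact support. -/
noncomputable def activeShiftCount {d : ℕ} (φ : (Fin d → ℝ) → ℝ) : ℕ := (activeShifts φ).ncard

/-! If `m` is the vector of integer parts of `2 ^ j * x`, only the active shifts `k` contribute to
`g x`, each through `c (m + k) * φ (2 ^ j * x - m - k)` (`sum_shifts_eq`). One subnetwork per `k`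
finds `m`, evaluates the given network at the shifted fractional part, and multiplies by a binary
approximation of the coefficient (`realizes_coefficient_mul_net`).

The coefficients are indexed by at most `2 ^ (d * j) ≤ (S * R) ^ 2` cells, where `S = 2 ^ s` and `R
= 2 ^ r`. Width of order `R` and depth of order `S` suffice to store one bit per cell: a lookup
treats `R` rows and `R` columns per block, using the `R * R` weights between two layers, and each
entry packs `S` bits that are peeled off one at a time (`realizes_bit_table`). Running `r'` tables
in parallel for `s'` rounds gives `r' * s'` bits, hence coefficient error at most `M * ε`. A bit
times a bounded nonnegative function is a single ReLU.

Integer parts are discontinuous, so this works only off thin strips (`exists_net_off_grid`). The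
strips are removed by evaluating at `3 ^ d` nearby points and taking nested medians: in each
coordinate at most one of three shifts is bad (`fract_shift_good`, `abs_medianTree_sub_le`). Half of
the error budget goes to the network off the strips, half to the displacement, by uniform continuity
of `g`.

Realizability is stated for functions on an arbitrary set `X`, so that integer parts can be realized
exactly on the complement of the strips. -/

/-! ### Affine spans of families of functions. -/

/-- The functions that are affine combinations of the members of the family `h`. -/
def affSpan {X ι : Type} (h : ι → X → ℝ) : Submodule ℝ (X → ℝ) :=
  Submodule.span ℝ (insert 1 (Set.range h))

/-- Coordinatewise ReLU of a family of functions. -/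
def reluFam {X ι : Type} (h : ι → X → ℝ) : ι → X → ℝ := fun i x => max 0 (h i x)

section affSpan

variable {X ι κ : Type} {h : ι → X → ℝ} {f g : X → ℝ}

lemma self_mem_affSpan (h : ι → X → ℝ) (i : ι) : h i ∈ affSpan h :=
  Submodule.subset_span (Set.mem_insert_of_mem _ ⟨i, rfl⟩)

lemma const_mem_affSpan (h : ι → X → ℝ) (c : ℝ) : (fun _ => c) ∈ affSpan h := by
  have h1 : (1 : X → ℝ) ∈ affSpan h := Submodule.subset_span (Set.mem_insert _ _)
  have h2 := (affSpan h).smul_mem c h1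
  convert h2 using 1
  ext x
  simp

lemma add_mem_affSpan (hf : f ∈ affSpan h) (hg : g ∈ affSpan h) :
    (fun x => f x + g x) ∈ affSpan h := (affSpan h).add_mem hf hg

lemma sub_mem_affSpan (hf : f ∈ affSpan h) (hg : g ∈ affSpan h) :
    (fun x => f x - g x) ∈ affSpan h := (affSpan h).sub_mem hf hg

lemma neg_mem_affSpan (hf : f ∈ affSpan h) : (fun x => -f x) ∈ affSpan h :=
  (affSpan h).neg_mem hf

lemma mul_mem_affSpan (c : ℝ) (hf : f ∈ affSpan h) : (fun x => c * f x) ∈ affSpan h :=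
  (affSpan h).smul_mem c hf

lemma sum_mem_affSpan {s : Finset κ} {F : κ → X → ℝ} (hF : ∀ k ∈ s, F k ∈ affSpan h) :
    (fun x => ∑ k ∈ s, F k x) ∈ affSpan h := by
  have := (affSpan h).sum_mem hF
  convert this using 1
  ext x
  simp

lemma affSpan_le {h' : κ → X → ℝ} (hh : ∀ i, h i ∈ affSpan h') : affSpan h ≤ affSpan h' := by
  refine Submodule.span_le.2 ?_
  rintro f (rfl | ⟨i, rfl⟩)
  · exact const_mem_affSpan h' 1
  · exact hh i

lemma relu_mem_affSpan (h : ι → X → ℝ) (i : ι) : (fun x => max 0 (h i x)) ∈ affSpan (reluFam h) :=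
  self_mem_affSpan (reluFam h) i

lemma nonneg_mem_affSpan (h : ι → X → ℝ) (i : ι) (hi : ∀ x, 0 ≤ h i x) :
    h i ∈ affSpan (reluFam h) := by
  convert relu_mem_affSpan h i using 1
  ext x
  exact (max_eq_right (hi x)).symm

lemma exists_of_mem_affSpan [Fintype ι] (hf : f ∈ affSpan h) :
    ∃ (a : ι → ℝ) (b : ℝ), ∀ x, f x = ∑ i, a i * h i x + b := by
  obtain ⟨b, z, hz, rfl⟩ := Submodule.mem_span_insert.1 hf
  obtain ⟨a, rfl⟩ := (Submodule.mem_span_range_iff_exists_fun ℝ).1 hz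
  exact ⟨a, b, fun x => by simp [add_comm]⟩

end affSpan

/-! ### Composition, parallel execution and carrying of layers. -/

/-- `Realizes inp W H h`: the family `h` is an affine image of the last hidden layer of a ReLU
network with inputs `inp` and exactly `H` hidden layers, each of width at most `W`. -/
inductive Realizes {X ι : Type} (inp : ι → X → ℝ) (W : ℕ) :
    ℕ → {κ : Type} → (κ → X → ℝ) → Prop
  | affine {κ : Type} {h : κ → X → ℝ} (hh : ∀ k, h k ∈ affSpan inp) : Realizes inp W 0 h
  | layer {κ κ' : Type} [Fintype κ'] {H : ℕ} {h' : κ' → X → ℝ} {h : κ → X → ℝ}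
      (hW : Fintype.card κ' ≤ W) (hr : Realizes inp W H h')
      (hh : ∀ k, h k ∈ affSpan (reluFam h')) : Realizes inp W (H + 1) h

namespace Realizes

variable {X ι κ κ' : Type} {inp : ι → X → ℝ} {W W' H H' : ℕ} {h : κ → X → ℝ} {g : κ' → X → ℝ}

lemma zero_inv (hr : Realizes inp W 0 h) : ∀ k, h k ∈ affSpan inp := by
  cases hr with
  | affine hh => exact hh

lemma succ_inv (hr : Realizes inp W (H + 1) h) : ∃ (α : Type) (_ : Fintype α) (h' : α → X → ℝ),
    Fintype.card α ≤ W ∧ Realizes inp W H h' ∧ ∀ k, h k ∈ affSpan (reluFam h') := by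
  cases hr with
  | layer hW hr hh => exact ⟨_, _, _, hW, hr, hh⟩

lemma post (hr : Realizes inp W H h) (hg : ∀ k, g k ∈ affSpan h) : Realizes inp W H g := by
  cases hr with
  | affine hh => exact .affine fun k => affSpan_le hh (hg k)
  | layer hW hr hh => exact .layer hW hr fun k => affSpan_le hh (hg k)

lemma mono (hr : Realizes inp W H h) (hW : W ≤ W') : Realizes inp W' H h := by
  induction hr with
  | affine hh => exact .affine hh
  | layer hc _ hh ih => exact .layer (hc.trans hW) ih hh

lemma trans (hr : Realizes inp W H h) (hs : Realizes h W H' g) : Realizes inp W (H + H') g := by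
  induction hs with
  | affine hh => exact hr.post hh
  | layer hc _ hh ih => exact .layer hc ih hh

lemma pre {ι' : Type} {inp' : ι' → X → ℝ} (hi : ∀ i, inp i ∈ affSpan inp')
    (hr : Realizes inp W H h) : Realizes inp' W H h := by
  simpa using (Realizes.affine (W := W) hi).trans hr

lemma single_layer [Fintype κ] (hin : ∀ k, h k ∈ affSpan inp) (hW : Fintype.card κ ≤ W)
    (hg : ∀ k, g k ∈ affSpan (reluFam h)) : Realizes inp W 1 g :=
  .layer hW (.affine hin) hg

lemma par (hr : Realizes inp W H h) (hs : Realizes inp W' H g) :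
    Realizes inp (W + W') H (Sum.elim h g) := by
  induction H generalizing κ κ' with
  | zero =>
    refine .affine ?_
    rintro (k | k)
    exacts [hr.zero_inv k, hs.zero_inv k]
  | succ H ih =>
    obtain ⟨α, _, a, ha, hra, hha⟩ := hr.succ_inv
    obtain ⟨β, _, b, hb, hrb, hhb⟩ := hs.succ_inv
    refine .layer (by simpa using add_le_add ha hb) (ih hra hrb) ?_
    rintro (k | k)
    · exact affSpan_le (fun i => self_mem_affSpan (reluFam (Sum.elim a b)) (Sum.inl i)) (hha k)
    · exact affSpan_le (fun i => self_mem_affSpan (reluFam (Sum.elim a b)) (Sum.inr i)) (hhb k)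

lemma par_family {α : Type} [Fintype α] {K : α → Type} {F : ∀ a, K a → X → ℝ}
    (hr : ∀ a, Realizes inp W H (F a)) :
    Realizes inp (Fintype.card α * W) H (fun p : Σ a, K a => F p.1 p.2) := by
  induction H generalizing K with
  | zero => exact .affine fun p => (hr p.1).zero_inv p.2
  | succ H ih =>
    choose β hβ b hb hrb hhb using fun a => (hr a).succ_inv
    refine .layer (κ' := Σ a, β a) ?_ (ih hrb) ?_
    · rw [Fintype.card_sigma]
      simpa using Finset.sum_le_card_nsmul Finset.univ _ W fun a _ => hb a
    · rintro ⟨a, k⟩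
      exact affSpan_le (fun i =>
        self_mem_affSpan (reluFam (fun p : Σ a, β a => b p.1 p.2)) ⟨a, i⟩) (hhb a k)

/-- ReLU fixes nonnegative functions, so transporting one through a layer costs one neuron instead
of two. -/
lemma carry [Fintype κ] (hn : ∀ k x, 0 ≤ h k x) (H : ℕ) : Realizes h (Fintype.card κ) H h := by
  induction H with
  | zero => exact .affine fun k => self_mem_affSpan h k
  | succ H ih => exact .layer le_rfl ih fun k => nonneg_mem_affSpan h k (hn k)

lemma with_carry [Fintype κ'] (hr : Realizes inp W H h) (hn : ∀ k x, 0 ≤ g k x) :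
    Realizes (Sum.elim inp g) (W + Fintype.card κ') H (Sum.elim h g) :=
  (hr.pre fun i => self_mem_affSpan (Sum.elim inp g) (Sum.inl i)).par
    ((carry hn H).pre fun i => self_mem_affSpan (Sum.elim inp g) (Sum.inr i))

end Realizes

/-! ### Passage between networks and realizations. -/

namespace ReLUNet

/-- The number of hidden layers. -/
def hiddenDepth {m : ℕ} : {n : ℕ} → ReLUNet m n → ℕ
  | _, output _ _ => 0
  | _, hidden _ _ rest => rest.hiddenDepth + 1

lemma depth_eq {m n : ℕ} (N : ReLUNet m n) : N.depth = N.hiddenDepth + 1 := by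
  induction N with
  | output A b => rfl
  | hidden A b rest ih => simp [depth, hiddenDepth, ih]

/-- Precomposition of a network with an affine map. -/
def preAffine {m n k : ℕ} (A' : Matrix (Fin n) (Fin k) ℝ) (b' : Fin n → ℝ) :
    ReLUNet m n → ReLUNet m k
  | output A b => output (A * A') (A.mulVec b' + b)
  | hidden A b rest => hidden (A * A') (A.mulVec b' + b) rest

lemma preAffine_spec {m n k : ℕ} (A' : Matrix (Fin n) (Fin k) ℝ) (b' : Fin n → ℝ)
    (N : ReLUNet m n) : (N.preAffine A' b').depth = N.depth ∧
      (N.preAffine A' b').width = N.width ∧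
      ∀ x, (N.preAffine A' b').eval x = N.eval (A'.mulVec x + b') := by
  cases N <;>
    simp [preAffine, depth, width, eval, Matrix.mulVec_add, ← Matrix.mulVec_mulVec, add_assoc]

lemma realizes {X : Type} {m n : ℕ} (N : ReLUNet m n) (h : Fin n → X → ℝ) :
    Realizes h N.width N.hiddenDepth (fun i x => N.eval (fun k => h k x) i) := by
  have key : ∀ {n k : ℕ} (A : Matrix (Fin k) (Fin n) ℝ) (b : Fin k → ℝ) (h : Fin n → X → ℝ) i,
      (fun x => (A.mulVec (fun k => h k x) + b) i) ∈ affSpan h := by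
    intro n k A b h i
    simp only [Pi.add_apply, Matrix.mulVec, dotProduct]
    exact add_mem_affSpan (sum_mem_affSpan fun k _ => mul_mem_affSpan _ (self_mem_affSpan h k))
      (const_mem_affSpan h _)
  induction N with
  | output A b => exact .affine (key A b h)
  | hidden A b rest ih =>
    have h1 : Realizes h (max (Fintype.card (Fin _)) rest.width) 1
        (reluFam fun i x => (A.mulVec (fun k => h k x) + b) i) :=
      .single_layer (key A b h) (le_max_left _ _) fun k => self_mem_affSpan _ k
    have h2 := h1.trans ((ih (reluFam fun i x => (A.mulVec (fun k => h k x) + b) i)).mono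
      (le_max_right _ _))
    simpa [width, hiddenDepth, eval, reluFam, add_comm] using h2

end ReLUNet

lemma affSpan_matrix {X ι κ : Type} [Fintype ι] {h : ι → X → ℝ} {g : κ → X → ℝ} {n k : ℕ}
    (e : Fin n ≃ ι) (e' : Fin k → κ) (hg : ∀ k, g k ∈ affSpan h) :
    ∃ (A : Matrix (Fin k) (Fin n) ℝ) (b : Fin k → ℝ), ∀ x,
      (fun i => g (e' i) x) = A.mulVec (fun i => h (e i) x) + b := by
  choose a b hab using fun k => exists_of_mem_affSpan (hg k)
  refine ⟨fun i l => a (e' i) (e l), fun i => b (e' i), fun x => ?_⟩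
  ext i
  simp only [Pi.add_apply, Matrix.mulVec, dotProduct, hab]
  rw [← e.sum_comp]

/-- `Realizes.layer` grows at the output while `ReLUNet.hidden` grows at the input. The induction
therefore carries an arbitrary network `N` still to be appended. -/
lemma Realizes.exists_net {X κ : Type} {d m W H k : ℕ} {inp : Fin d → X → ℝ} {h : κ → X → ℝ}
    (hr : Realizes inp W H h) (e : Fin k → κ) (N : ReLUNet m k) :
    ∃ N' : ReLUNet m d, N'.depth = H + N.depth ∧ N'.width ≤ max W N.width ∧
      ∀ x, N'.eval (fun i => inp i x) = N.eval (fun i => h (e i) x) := by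
  induction hr generalizing k with
  | affine hh =>
    obtain ⟨A, b, hA⟩ := affSpan_matrix (Equiv.refl (Fin d)) e hh
    obtain ⟨h1, h2, h3⟩ := ReLUNet.preAffine_spec A b N
    refine ⟨N.preAffine A b, by simp [h1], by simp [h2], fun x => ?_⟩
    rw [h3, hA]
    rfl
  | @layer κ κ' _ H h' h hW hr hh ih =>
    let e' := (Fintype.equivFin κ').symm
    obtain ⟨A, b, hA⟩ := affSpan_matrix e' e hh
    obtain ⟨h1, h2, h3⟩ := ReLUNet.preAffine_spec A b N
    -- The hidden layer has identity weights because `h'` is already the preactivation.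
    obtain ⟨N', g1, g2, g3⟩ := ih e' (.hidden (1 : Matrix _ _ ℝ) 0 (N.preAffine A b))
    refine ⟨N', ?_, ?_, fun x => ?_⟩
    · simp [g1, ReLUNet.depth, h1]
      ring
    · refine g2.trans ?_
      simp only [ReLUNet.width, h2]
      omega
    · rw [g3, hA]
      simp [ReLUNet.eval, h3, reluFam]

lemma Realizes.exists_scalar_net {X : Type} {d W H : ℕ} {inp : Fin d → X → ℝ} {f : X → ℝ}
    (hr : Realizes inp W H ![f]) :
    ∃ N : ReLUNet 1 d, N.depth = H + 1 ∧ N.width ≤ W ∧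
      ∀ x, N.eval (fun i => inp i x) 0 = f x := by
  obtain ⟨N, h1, h2, h3⟩ := hr.exists_net id (.output (1 : Matrix (Fin 1) (Fin 1) ℝ) 0)
  refine ⟨N, h1, by simpa [ReLUNet.width] using h2, fun x => ?_⟩
  simp [h3, ReLUNet.eval]

/-! ### Integer parts and integer division by staircases. -/

lemma sum_indicator_lt_fin (c v R : ℕ) :
    ∑ a : Fin R, (if c + a < v then 1 else 0 : ℕ) = min v (c + R) - min v c := by
  rw [Fin.sum_univ_eq_sum_range (fun a => if c + a < v then 1 else 0)]
  induction R with
  | zero => simp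
  | succ R ih =>
    rw [Finset.sum_range_succ, ih]
    split_ifs <;> omega

lemma sum_indicator_lt (v R S : ℕ) :
    ∑ l ∈ Finset.range S, ∑ a : Fin R, (if l * R + a < v then 1 else 0 : ℕ) = min v (S * R) := by
  induction S with
  | zero => simp
  | succ S ih =>
    rw [Finset.sum_range_succ, ih, sum_indicator_lt_fin, Nat.succ_mul]
    omega

/-- A ramp of slope `1 / η` agrees with the jump at `θ` because `u` avoids the open interval where
the ramp rises. -/
lemma relu_step {θ η u : ℝ} (hη : 0 < η) (h : θ ≤ u ∨ u ≤ θ - η) :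
    max 0 ((u - θ) / η + 1) - max 0 ((u - θ) / η) = if θ ≤ u then 1 else 0 := by
  split_ifs with h1
  · have : 0 ≤ (u - θ) / η := div_nonneg (by linarith) hη.le
    rw [max_eq_right this, max_eq_right (by linarith)]
    ring
  · have h2 : (u - θ) / η ≤ -1 := by
      rw [div_le_iff₀ hη]
      linarith [h.resolve_left h1]
    rw [max_eq_left (by linarith), max_eq_left (by linarith)]
    ring

/-- Each layer adds `R` thresholds, with two neurons per threshold and two more to carry `u` and the
running count. -/
lemma realizes_staircase {X : Type} {u : X → ℝ} (hu : ∀ x, 0 ≤ u x) {η : ℝ} (hη : 0 < η) (R : ℕ)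
    (θ : ℕ → ℕ → ℝ) (hgood : ∀ l a x, θ l a ≤ u x ∨ u x ≤ θ l a - η) (S : ℕ) :
    Realizes ![u] (2 * R + 2) S
      ![u, fun x => ∑ l ∈ Finset.range S, ∑ a : Fin R, if θ l a ≤ u x then 1 else 0] := by
  induction S with
  | zero =>
    refine .affine fun k => ?_
    fin_cases k
    · exact self_mem_affSpan ![u] 0
    · simpa using const_mem_affSpan ![u] 0
  | succ S ih =>
    set A : X → ℝ := fun x => ∑ l ∈ Finset.range S, ∑ a : Fin R, if θ l a ≤ u x then 1 else 0
      with hA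
    let F : Fin 2 ⊕ (Fin R ⊕ Fin R) → X → ℝ := Sum.elim ![u, A]
      (Sum.elim (fun a x => (u x - θ S a) / η + 1) (fun a x => (u x - θ S a) / η))
    have hu' : u ∈ affSpan ![u, A] := self_mem_affSpan ![u, A] 0
    have hdiv : ∀ c : ℝ, (fun x => (u x - c) / η) ∈ affSpan ![u, A] := fun c => by
      simp only [div_eq_inv_mul]
      exact mul_mem_affSpan _ (sub_mem_affSpan hu' (const_mem_affSpan _ _))
    refine ih.trans (.single_layer (h := F) ?_ ?_ ?_)
    · rintro (k | k | k)
      · exact self_mem_affSpan _ k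
      · exact add_mem_affSpan (hdiv _) (const_mem_affSpan _ _)
      · exact hdiv _
    · simp
      omega
    · intro k
      fin_cases k
      · exact nonneg_mem_affSpan F (Sum.inl 0) hu
      · have h1 : A ∈ affSpan (reluFam F) := nonneg_mem_affSpan F (Sum.inl 1) fun x => by
          change 0 ≤ A x
          positivity
        have h2 := add_mem_affSpan h1 (sum_mem_affSpan (s := Finset.univ) fun (a : Fin R) _ =>
          sub_mem_affSpan (relu_mem_affSpan F (Sum.inr (Sum.inl a)))
            (relu_mem_affSpan F (Sum.inr (Sum.inr a))))
        convert h2 using 1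
        ext x
        simp [Finset.sum_range_succ, hA, F, relu_step hη (hgood _ _ _)]

/-- Division of the integer part `m` of `u` by `D`, with thresholds at the multiples of `D`. -/
lemma realizes_floor_div {X : Type} {u : X → ℝ} {m : X → ℕ} {η : ℝ} (hη : 0 < η)
    (h1 : ∀ x, (m x : ℝ) ≤ u x) (h2 : ∀ x, u x ≤ m x + 1 - η) (R S D : ℕ) (hD : 0 < D)
    (hm : ∀ x, m x / D ≤ S * R) :
    Realizes ![u] (2 * R + 2) S ![u, fun x => ((m x / D : ℕ) : ℝ)] := by
  have hu : ∀ x, 0 ≤ u x := fun x => (Nat.cast_nonneg _).trans (h1 x)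
  have hiff : ∀ (t : ℕ) x, ((t * D : ℕ) : ℝ) ≤ u x ↔ t * D ≤ m x := by
    intro t x
    refine ⟨fun h => ?_, fun h => (Nat.cast_le.2 h).trans (h1 x)⟩
    have : ((t * D : ℕ) : ℝ) < ((m x + 1 : ℕ) : ℝ) := by
      push_cast at h ⊢
      linarith [h2 x]
    exact Nat.lt_succ_iff.1 (Nat.cast_lt.1 this)
  have key := realizes_staircase hu hη R (fun l a => (((l * R + a + 1) * D : ℕ) : ℝ)) (by
    intro l a x
    by_cases h : (l * R + a + 1) * D ≤ m x
    · exact .inl ((hiff _ _).2 h)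
    · right
      have : ((m x + 1 : ℕ) : ℝ) ≤ (((l * R + a + 1) * D : ℕ) : ℝ) := Nat.cast_le.2 (by omega)
      push_cast at this ⊢
      linarith [h2 x]) S
  convert key using 3
  ext x
  simp only [hiff, ← Nat.le_div_iff_mul_le hD, Nat.succ_le_iff]
  have := sum_indicator_lt (m x / D) R S
  rw [min_eq_left (hm x)] at this
  exact_mod_cast this.symm

/-- Two base-`Q` digits reach `Q * Q` values with only `2 * S` layers: after the quotient `q` is
known, `u - Q * q` keeps the same gap `η` and has integer part below `Q`. -/
lemma realizes_floor {X : Type} {u : X → ℝ} {m : X → ℕ} {η : ℝ} (hη : 0 < η)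
    (h1 : ∀ x, (m x : ℝ) ≤ u x) (h2 : ∀ x, u x ≤ m x + 1 - η) (R S : ℕ)
    (hQ : 0 < S * R) (hm : ∀ x, m x < S * R * (S * R)) :
    Realizes ![u] (2 * R + 3) (S + S) ![u, fun x => (m x : ℝ)] := by
  set Q := S * R with hQdef
  let q : X → ℝ := fun x => ((m x / Q : ℕ) : ℝ)
  let p : X → ℝ := fun x => ((m x % Q : ℕ) : ℝ)
  have hmod : ∀ x, (m x : ℝ) = Q * q x + p x := fun x => by
    simp only [q, p]
    exact_mod_cast (Nat.div_add_mod (m x) Q).symm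
  have s1 := realizes_floor_div hη h1 h2 R S Q hQ fun x => (Nat.div_lt_of_lt_mul (hm x)).le
  let v : X → ℝ := fun x => u x - Q * q x
  have s2 : Realizes ![v] (2 * R + 2) S ![v, p] := by
    have := realizes_floor_div (u := v) (m := fun x => m x % Q) hη
      (fun x => by have := h1 x; have := hmod x; simp only [v, p] at *; linarith)
      (fun x => by have := h2 x; have := hmod x; simp only [v, p] at *; linarith) R S 1 one_pos
      (fun x => by simpa using (Nat.mod_lt _ hQ).le)
    simpa using this
  have s3 := s2.with_carry (g := ![q]) fun k x => by
    fin_cases k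
    exact Nat.cast_nonneg _
  have hq : q ∈ affSpan ![u, q] := self_mem_affSpan ![u, q] 1
  have s4 := s3.pre (inp' := ![u, q]) (by
    rintro (k | k)
    · fin_cases k
      exact sub_mem_affSpan (self_mem_affSpan ![u, q] 0) (mul_mem_affSpan _ hq)
    · fin_cases k
      exact hq)
  refine ((s1.mono (by omega)).trans (s4.mono (by simp))).post ?_
  have hv := self_mem_affSpan (Sum.elim ![v, p] ![q]) (Sum.inl 0)
  have hp := self_mem_affSpan (Sum.elim ![v, p] ![q]) (Sum.inl 1)
  have hq := self_mem_affSpan (Sum.elim ![v, p] ![q]) (Sum.inr 0)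
  intro k
  fin_cases k
  · convert add_mem_affSpan hv (mul_mem_affSpan Q hq) using 1
    ext x
    simp [v]
  · convert add_mem_affSpan (mul_mem_affSpan Q hq) hp using 1
    ext x
    exact hmod x

/-! ### Table lookup. -/

lemma relu_indicator (q v : ℕ) :
    max 0 ((q : ℝ) - v + 1) - 2 * max 0 ((q : ℝ) - v) + max 0 ((q : ℝ) - v - 1) =
      if q = v then 1 else 0 := by
  rcases lt_trichotomy q v with h | h | h
  · have : (q : ℝ) + 1 ≤ v := by exact_mod_cast h
    rw [max_eq_left (by linarith), max_eq_left (by linarith), max_eq_left (by linarith),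
      if_neg h.ne]
    ring
  · subst h
    simp
  · have : (v : ℝ) + 1 ≤ q := by exact_mod_cast h
    rw [max_eq_right (by linarith), max_eq_right (by linarith), max_eq_right (by linarith),
      if_neg h.ne']
    ring

lemma relu_abs (b c : ℝ) : max 0 (b - c) + max 0 (c - b) = |b - c| := by
  rcases le_total b c with h | h
  · rw [max_eq_left (by linarith), max_eq_right (by linarith), abs_of_nonpos (by linarith)]
    ring
  · rw [max_eq_right (by linarith), max_eq_left (by linarith), abs_of_nonneg (by linarith)]
    ring

/-- Distinct integers are at distance at least `1`, which absorbs any `t ≤ 1`. -/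
lemma relu_gate {t : ℝ} (h0 : 0 ≤ t) (h1 : t ≤ 1) (b c : ℕ) :
    max 0 (t - |(b : ℝ) - c|) = if b = c then t else 0 := by
  split_ifs with h
  · subst h
    simpa using h0
  · refine max_eq_left ?_
    have : (1 : ℝ) ≤ |(b : ℝ) - c| := by
      have : (1 : ℤ) ≤ |(b : ℤ) - c| := Int.one_le_abs (by omega)
      exact_mod_cast this
    linarith

/-- One block of a table lookup: the rows `l * R, …, l * R + R - 1`. -/
lemma realizes_lookup_step {X : Type} {q b : X → ℕ} (R l : ℕ) (T : ℕ → ℕ → ℝ)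
    (hT0 : ∀ i k, 0 ≤ T i k) (hT1 : ∀ i k, T i k ≤ 1) (hb : ∀ x, b x < R) :
    Realizes ![fun x => (q x : ℝ), fun x => (b x : ℝ),
        fun x => if q x < l * R then T (q x) (b x) else 0] (5 * R + 3) 2
      ![fun x => (q x : ℝ), fun x => (b x : ℝ),
        fun x => if q x < (l + 1) * R then T (q x) (b x) else 0] := by
  set A : X → ℝ := fun x => if q x < l * R then T (q x) (b x) else 0 with hA
  let qr : X → ℝ := fun x => (q x : ℝ)
  let br : X → ℝ := fun x => (b x : ℝ)
  have hA0 : ∀ x, 0 ≤ A x := fun x => by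
    simp only [hA]
    split_ifs
    exacts [hT0 _ _, le_rfl]
  -- Three neurons per row give the indicator of `q` as a second difference, two per column give `|b
  -- - c|`, and three carry the state.
  let F : Fin 3 ⊕ (Fin R ⊕ Fin R ⊕ Fin R ⊕ Fin R ⊕ Fin R) → X → ℝ :=
    Sum.elim ![qr, br, A] (Sum.elim (fun a x => qr x - ((l * R + a : ℕ) : ℝ) + 1)
      (Sum.elim (fun a x => qr x - ((l * R + a : ℕ) : ℝ))
      (Sum.elim (fun a x => qr x - ((l * R + a : ℕ) : ℝ) - 1)
      (Sum.elim (fun c x => br x - (c : ℕ)) (fun c x => (c : ℕ) - br x)))))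
  let ind : Fin R → X → ℝ := fun a x => if q x = l * R + a then 1 else 0
  let dist : Fin R → X → ℝ := fun c x => |br x - (c : ℕ)|
  have hind : ∀ a, ind a ∈ affSpan (reluFam F) := fun a => by
    have := add_mem_affSpan (sub_mem_affSpan (relu_mem_affSpan F (.inr (.inl a)))
      (mul_mem_affSpan 2 (relu_mem_affSpan F (.inr (.inr (.inl a))))))
      (relu_mem_affSpan F (.inr (.inr (.inr (.inl a)))))
    convert this using 1
    ext x
    exact (relu_indicator (q x) (l * R + a)).symm
  have hdist : ∀ c, dist c ∈ affSpan (reluFam F) := fun c => by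
    have := add_mem_affSpan (relu_mem_affSpan F (.inr (.inr (.inr (.inr (.inl c))))))
      (relu_mem_affSpan F (.inr (.inr (.inr (.inr (.inr c))))))
    convert this using 1
    ext x
    exact (relu_abs _ _).symm
  -- The table sits in these weights. The sum is column `c` of the selected row, or `0` if `q` lies
  -- outside the block; the next ReLU keeps only the column `c = b`.
  let G : Fin 3 ⊕ Fin R → X → ℝ := Sum.elim ![qr, br, A]
    (fun c x => (∑ a : Fin R, T (l * R + a) c * ind a x) - dist c x)
  have h1 : Realizes ![qr, br, A] (5 * R + 3) 1 G := by
    refine .single_layer (h := F) ?_ ?_ ?_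
    · have hq : qr ∈ affSpan ![qr, br, A] := self_mem_affSpan ![qr, br, A] 0
      have hb : br ∈ affSpan ![qr, br, A] := self_mem_affSpan ![qr, br, A] 1
      rintro (k | k | k | k | k | k)
      · exact self_mem_affSpan _ k
      · exact add_mem_affSpan (sub_mem_affSpan hq (const_mem_affSpan _ _)) (const_mem_affSpan _ _)
      · exact sub_mem_affSpan hq (const_mem_affSpan _ _)
      · exact sub_mem_affSpan (sub_mem_affSpan hq (const_mem_affSpan _ _)) (const_mem_affSpan _ _)
      · exact sub_mem_affSpan hb (const_mem_affSpan _ _)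
      · exact sub_mem_affSpan (const_mem_affSpan _ _) hb
    · simp
      omega
    · rintro (k | c)
      · fin_cases k
        · exact nonneg_mem_affSpan F (.inl 0) fun x => Nat.cast_nonneg _
        · exact nonneg_mem_affSpan F (.inl 1) fun x => Nat.cast_nonneg _
        · exact nonneg_mem_affSpan F (.inl 2) hA0
      · exact sub_mem_affSpan (sum_mem_affSpan fun a _ => mul_mem_affSpan _ (hind a)) (hdist c)
  refine h1.trans (H' := 1) (.single_layer (h := G) (fun k => self_mem_affSpan G k) ?_ ?_)
  · simp
    omega
  · intro k
    fin_cases k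
    · exact nonneg_mem_affSpan G (.inl 0) fun x => Nat.cast_nonneg _
    · exact nonneg_mem_affSpan G (.inl 1) fun x => Nat.cast_nonneg _
    · have := add_mem_affSpan (nonneg_mem_affSpan G (.inl 2) hA0)
        (sum_mem_affSpan (s := Finset.univ) fun (c : Fin R) _ => relu_mem_affSpan G (.inr c))
      convert this using 1
      ext x
      have hrow : ∀ c : Fin R, ∑ a : Fin R, T (l * R + a) c * ind a x =
          if l * R ≤ q x ∧ q x < (l + 1) * R then T (q x) c else 0 := by
        intro c
        split_ifs with h
        · rw [Nat.succ_mul] at h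
          rw [Finset.sum_eq_single ⟨q x - l * R, by omega⟩]
          · have : l * R + (q x - l * R) = q x := by omega
            simp [ind, this]
          · intro a _ ha
            have : q x ≠ l * R + a := fun h' => ha (Fin.ext (by simp; omega))
            simp [ind, this]
          · simp
        · refine Finset.sum_eq_zero fun a _ => ?_
          have : q x ≠ l * R + a := by
            rw [Nat.succ_mul] at h
            have := a.2
            omega
          simp [ind, this]
      have hsum : ∑ c : Fin R, max 0 (G (.inr c) x) =
          if l * R ≤ q x ∧ q x < (l + 1) * R then T (q x) (b x) else 0 := by
        have : ∀ c : Fin R, max 0 (G (.inr c) x) = if b x = c then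
            (if l * R ≤ q x ∧ q x < (l + 1) * R then T (q x) c else 0) else 0 := by
          intro c
          have h3 := hrow c
          simp only [G, Sum.elim_inr, h3, dist, br]
          refine relu_gate ?_ ?_ _ _ <;> split_ifs <;> first | exact hT0 _ _ | exact hT1 _ _ | simp
        simp only [this]
        rw [Finset.sum_eq_single ⟨b x, hb x⟩]
        · simp
        · intro c _ hc
          rw [if_neg fun h' => hc (Fin.ext h'.symm)]
        · simp
      rw [hsum]
      have h4 : l * R ≤ (l + 1) * R := by rw [Nat.succ_mul]; omega
      change (if q x < (l + 1) * R then T (q x) (b x) else 0) = A x + _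
      simp only [hA]
      split_ifs <;> first | omega | simp

lemma realizes_lookup {X : Type} {q b : X → ℕ} (R S : ℕ) (T : ℕ → ℕ → ℝ)
    (hT0 : ∀ i k, 0 ≤ T i k) (hT1 : ∀ i k, T i k ≤ 1) (hb : ∀ x, b x < R)
    (hq : ∀ x, q x < S * R) :
    Realizes ![fun x => (q x : ℝ), fun x => (b x : ℝ)] (5 * R + 3) (2 * S)
      ![fun x => T (q x) (b x)] := by
  have key : ∀ l, Realizes ![fun x => (q x : ℝ), fun x => (b x : ℝ)] (5 * R + 3) (2 * l)
      ![fun x => (q x : ℝ), fun x => (b x : ℝ),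
        fun x => if q x < l * R then T (q x) (b x) else 0] := by
    intro l
    induction l with
    | zero =>
      refine .affine fun k => ?_
      fin_cases k
      · exact self_mem_affSpan ![fun x => (q x : ℝ), fun x => (b x : ℝ)] 0
      · exact self_mem_affSpan ![fun x => (q x : ℝ), fun x => (b x : ℝ)] 1
      · simpa using const_mem_affSpan ![fun x => (q x : ℝ), fun x => (b x : ℝ)] 0
    | succ l ih => exact ih.trans (realizes_lookup_step R l T hT0 hT1 hb)
  refine (key S).post fun k => ?_
  fin_cases k
  have := self_mem_affSpan ![fun x => (q x : ℝ), fun x => (b x : ℝ),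
        fun x => if q x < S * R then T (q x) (b x) else 0] 2
  simpa [hq] using this

/-! ### Bit extraction from ternary words. -/

/-- The number with ternary digits `β t, …, β (t + n - 1)`. -/
noncomputable def ternaryCode (β : ℕ → ℝ) : ℕ → ℕ → ℝ
  | 0, _ => 0
  | n + 1, t => (β t + ternaryCode β n (t + 1)) / 3

lemma ternaryCode_bounds {β : ℕ → ℝ} (hβ : ∀ t, β t = 0 ∨ β t = 1) (n t : ℕ) :
    0 ≤ ternaryCode β n t ∧ ternaryCode β n t ≤ 1 / 2 := by
  induction n generalizing t with
  | zero => norm_num [ternaryCode]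
  | succ n ih =>
    obtain ⟨h1, h2⟩ := ih (t + 1)
    rw [ternaryCode]
    rcases hβ t with h | h <;> rw [h] <;> constructor <;> linarith

/-- Leaving digit `2` unused creates a gap: the word is at most `1 / 6` or at least `1 / 3`
according to its leading digit, so a continuous clamp reads that digit exactly. -/
lemma relu_ternary {β c : ℝ} (hβ : β = 0 ∨ β = 1) (h0 : 0 ≤ c) (h1 : c ≤ 1 / 2) :
    max 0 (6 * ((β + c) / 3) - 1) - max 0 (6 * ((β + c) / 3) - 2) = β := by
  rcases hβ with rfl | rfl
  · rw [max_eq_left (by linarith), max_eq_left (by linarith)]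
    ring
  · rw [max_eq_right (by linarith), max_eq_right (by linarith)]
    ring

/-- The first layer reads the leading bit and shifts the word by `3 * w - β`; the second adds that
bit to the accumulator only when `i = t`. -/
lemma realizes_extract_step {X : Type} {i : X → ℕ} {β : X → ℕ → ℝ}
    (hβ : ∀ x t, β x t = 0 ∨ β x t = 1) (n t : ℕ) :
    Realizes ![fun x => ternaryCode (β x) (n + 1) t, fun x => (i x : ℝ),
        fun x => if i x < t then β x (i x) else 0] 7 2
      ![fun x => ternaryCode (β x) n (t + 1), fun x => (i x : ℝ),
        fun x => if i x < t + 1 then β x (i x) else 0] := by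
  have hβ0 : ∀ x t, 0 ≤ β x t := fun x t => by rcases hβ x t with h | h <;> simp [h]
  have hβ1 : ∀ x t, β x t ≤ 1 := fun x t => by rcases hβ x t with h | h <;> simp [h]
  set w : X → ℝ := fun x => ternaryCode (β x) (n + 1) t with hw
  set A : X → ℝ := fun x => if i x < t then β x (i x) else 0 with hA
  let ir : X → ℝ := fun x => (i x : ℝ)
  have hA0 : ∀ x, 0 ≤ A x := fun x => by
    simp only [hA]
    split_ifs
    exacts [hβ0 _ _, le_rfl]
  let F : Fin 7 → X → ℝ := ![w, ir, A, fun x => 6 * w x - 1, fun x => 6 * w x - 2,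
    fun x => ir x - t, fun x => t - ir x]
  have hbit : (fun x => β x t) ∈ affSpan (reluFam F) := by
    convert sub_mem_affSpan (relu_mem_affSpan F 3) (relu_mem_affSpan F 4) using 1
    ext x
    obtain ⟨h0, h1⟩ := ternaryCode_bounds (hβ x) n (t + 1)
    exact (relu_ternary (hβ x t) h0 h1).symm
  have hdist : (fun x => |ir x - t|) ∈ affSpan (reluFam F) := by
    convert add_mem_affSpan (relu_mem_affSpan F 5) (relu_mem_affSpan F 6) using 1
    ext x
    exact (relu_abs _ _).symm
  let w' : X → ℝ := fun x => ternaryCode (β x) n (t + 1)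
  let G : Fin 4 → X → ℝ := ![w', ir, A, fun x => β x t - |ir x - t|]
  have h1 : Realizes ![w, ir, A] 7 1 G := by
    refine .single_layer (h := F) ?_ (by simp) ?_
    · have hw : w ∈ affSpan ![w, ir, A] := self_mem_affSpan ![w, ir, A] 0
      have hi : ir ∈ affSpan ![w, ir, A] := self_mem_affSpan ![w, ir, A] 1
      intro k
      fin_cases k
      · exact hw
      · exact hi
      · exact self_mem_affSpan ![w, ir, A] 2
      · exact sub_mem_affSpan (mul_mem_affSpan _ hw) (const_mem_affSpan _ _)
      · exact sub_mem_affSpan (mul_mem_affSpan _ hw) (const_mem_affSpan _ _)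
      · exact sub_mem_affSpan hi (const_mem_affSpan _ _)
      · exact sub_mem_affSpan (const_mem_affSpan _ _) hi
    · intro k
      fin_cases k
      · have := sub_mem_affSpan (mul_mem_affSpan 3 (nonneg_mem_affSpan F 0 fun x =>
          (ternaryCode_bounds (hβ x) (n + 1) t).1)) hbit
        convert this using 1
        ext x
        simp only [F, hw, Matrix.cons_val_zero, ternaryCode]
        change ternaryCode (β x) n (t + 1) = _
        ring
      · exact nonneg_mem_affSpan F 1 fun x => Nat.cast_nonneg _
      · exact nonneg_mem_affSpan F 2 hA0
      · exact sub_mem_affSpan hbit hdist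
  refine h1.trans (H' := 1) (.single_layer (h := G) (fun k => self_mem_affSpan G k) (by simp) ?_)
  intro k
  fin_cases k
  · exact nonneg_mem_affSpan G 0 fun x => (ternaryCode_bounds (hβ x) n (t + 1)).1
  · exact nonneg_mem_affSpan G 1 fun x => Nat.cast_nonneg _
  · have := add_mem_affSpan (nonneg_mem_affSpan G 2 hA0) (relu_mem_affSpan G 3)
    convert this using 1
    ext x
    change (if i x < t + 1 then β x (i x) else 0) = A x + max 0 (β x t - |(i x : ℝ) - t|)
    rw [relu_gate (hβ0 x t) (hβ1 x t)]
    simp only [hA]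
    rcases lt_trichotomy (i x) t with h | h | h
    · rw [if_pos (by omega), if_pos h, if_neg h.ne, add_zero]
    · rw [if_pos (by omega), if_neg (by omega), if_pos h, zero_add, h]
    · rw [if_neg (by omega), if_neg (by omega), if_neg (by omega), add_zero]

lemma realizes_extract {X : Type} {i : X → ℕ} {β : X → ℕ → ℝ}
    (hβ : ∀ x t, β x t = 0 ∨ β x t = 1) (S : ℕ) (hi : ∀ x, i x < S) :
    Realizes ![fun x => ternaryCode (β x) S 0, fun x => (i x : ℝ)] 7 (2 * S)
      ![fun x => β x (i x)] := by
  -- The number `n` of digits still unread is left free, since it drops by one whenever `t` grows.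
  have key : ∀ t n, Realizes ![fun x => ternaryCode (β x) (n + t) 0, fun x => (i x : ℝ)] 7 (2 * t)
      ![fun x => ternaryCode (β x) n t, fun x => (i x : ℝ),
        fun x => if i x < t then β x (i x) else 0] := by
    intro t
    induction t with
    | zero =>
      intro n
      refine .affine fun k => ?_
      have := self_mem_affSpan ![fun x => ternaryCode (β x) n 0, fun x => (i x : ℝ)]
      fin_cases k
      · exact this 0
      · exact this 1
      · simpa using const_mem_affSpan ![fun x => ternaryCode (β x) n 0, fun x => (i x : ℝ)] 0
    | succ t ih =>
      intro n
      have := (ih (n + 1)).trans (realizes_extract_step hβ n t)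
      rwa [show n + 1 + t = n + (t + 1) by omega] at this
  have := key S 0
  rw [zero_add] at this
  refine this.post fun k => ?_
  fin_cases k
  have := self_mem_affSpan ![fun x => ternaryCode (β x) 0 S, fun x => (i x : ℝ),
        fun x => if i x < S then β x (i x) else 0] 2
  simpa [hi] using this

/-- Extraction of an arbitrary table of `S * R * R * S` bits. -/
lemma realizes_bit_table {X : Type} {q b i : X → ℕ} (R S : ℕ) (hR : 1 ≤ R)
    (β : ℕ → ℕ → ℕ → ℝ) (hβ : ∀ q b t, β q b t = 0 ∨ β q b t = 1)
    (hq : ∀ x, q x < S * R) (hb : ∀ x, b x < R) (hi : ∀ x, i x < S) :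
    Realizes ![fun x => (q x : ℝ), fun x => (b x : ℝ), fun x => (i x : ℝ)] (14 * R) (4 * S)
      ![fun x => β (q x) (b x) (i x)] := by
  let qr : X → ℝ := fun x => (q x : ℝ)
  let br : X → ℝ := fun x => (b x : ℝ)
  let ir : X → ℝ := fun x => (i x : ℝ)
  let T : ℕ → ℕ → ℝ := fun q b => ternaryCode (β q b) S 0
  have hT := fun q b => ternaryCode_bounds (hβ q b) S 0
  have h1 := realizes_lookup (q := q) (b := b) R S T (fun q b => (hT q b).1)
    (fun q b => (hT q b).2.trans (by norm_num)) hb hq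
  have h2 := h1.with_carry (g := ![ir]) fun k x => by
    fin_cases k
    exact Nat.cast_nonneg _
  have h3 := h2.pre (inp' := ![qr, br, ir]) (by
    have := self_mem_affSpan ![qr, br, ir]
    rintro (k | k) <;> fin_cases k
    exacts [this 0, this 1, this 2])
  have h4 := h3.post (g := ![fun x => T (q x) (b x), ir]) (by
    have := self_mem_affSpan (Sum.elim ![fun x => T (q x) (b x)] ![ir])
    intro k
    fin_cases k
    exacts [this (.inl 0), this (.inr 0)])
  have h5 := realizes_extract (i := i) (β := fun x => β (q x) (b x))
    (fun x t => hβ _ _ _) S hi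
  have h6 := (h4.mono (show 5 * R + 3 + Fintype.card (Fin 1) ≤ 14 * R by simp; omega)).trans
    (h5.mono (show 7 ≤ 14 * R by omega))
  rwa [show 2 * S + 2 * S = 4 * S by ring] at h6

/-! ### Multiplication by numbers given through their bits. -/

/-- For a bit `β` and `0 ≤ t ≤ V`, the product `β * t` equals `max 0 (t + V * β - V)`. The plain bit
sum `a₂` is kept too, so that a shift making `t` nonnegative can be undone later. -/
lemma realizes_round {X : Type} {q b i : X → ℕ} {R S : ℕ} (hR : 1 ≤ R)
    (hq : ∀ x, q x < S * R) (hb : ∀ x, b x < R) (hi : ∀ x, i x < S) (r' : ℕ)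
    (β : Fin r' → ℕ → ℕ → ℕ → ℝ) (hβ : ∀ p q b t, β p q b t = 0 ∨ β p q b t = 1)
    (wt : Fin r' → ℝ) {V : ℝ} {t a₁ a₂ : X → ℝ} (ht0 : ∀ x, 0 ≤ t x) (ht1 : ∀ x, t x ≤ V)
    (ha₁ : ∀ x, 0 ≤ a₁ x) (ha₂ : ∀ x, 0 ≤ a₂ x) :
    Realizes ![fun x => (q x : ℝ), fun x => (b x : ℝ), fun x => (i x : ℝ), t, a₁, a₂]
      (r' * (14 * R) + 6) (4 * S + 1)
      ![fun x => (q x : ℝ), fun x => (b x : ℝ), fun x => (i x : ℝ), t,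
        fun x => a₁ x + ∑ p, wt p * (β p (q x) (b x) (i x) * t x),
        fun x => a₂ x + ∑ p, wt p * β p (q x) (b x) (i x)] := by
  set st : Fin 6 → X → ℝ :=
    ![fun x => (q x : ℝ), fun x => (b x : ℝ), fun x => (i x : ℝ), t, a₁, a₂] with hst
  have hst0 : ∀ k x, 0 ≤ st k x := by
    intro k x
    fin_cases k
    exacts [Nat.cast_nonneg _, Nat.cast_nonneg _, Nat.cast_nonneg _, ht0 x, ha₁ x, ha₂ x]
  let bit : Fin r' → X → ℝ := fun p x => β p (q x) (b x) (i x)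
  have hbit0 : ∀ p x, 0 ≤ bit p x := fun p x => by
    rcases hβ p (q x) (b x) (i x) with h | h <;> simp [bit, h]
  have h1 := (Realizes.par_family fun p : Fin r' =>
    realizes_bit_table R S hR (β p) (hβ p) hq hb hi).with_carry hst0
  have h2 := h1.pre (inp' := st) (by
    rintro (k | k)
    · fin_cases k
      exacts [self_mem_affSpan st 0, self_mem_affSpan st 1, self_mem_affSpan st 2]
    · exact self_mem_affSpan st k)
  rw [Fintype.card_fin, Fintype.card_fin] at h2
  let F : Fin 6 ⊕ (Fin r' ⊕ Fin r') → X → ℝ :=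
    Sum.elim st (Sum.elim bit fun p x => t x + V * bit p x - V)
  have h3 := h2.post (g := F) (by
    set G := Sum.elim (fun (p : Σ _ : Fin r', Fin 1) =>
      (![fun x => β p.1 (q x) (b x) (i x)] : Fin 1 → X → ℝ) p.2) st
    have hb : ∀ p, bit p ∈ affSpan G := fun p => self_mem_affSpan G (.inl ⟨p, 0⟩)
    have hs : ∀ k, st k ∈ affSpan G := fun k => self_mem_affSpan G (.inr k)
    rintro (k | k | k)
    · exact hs k
    · exact hb k
    · exact sub_mem_affSpan (add_mem_affSpan (hs 3) (mul_mem_affSpan _ (hb k)))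
        (const_mem_affSpan _ _))
  refine Realizes.layer ?_ h3 ?_
  · have : r' ≤ r' * R := Nat.le_mul_of_pos_right _ hR
    simp only [Fintype.card_sum, Fintype.card_fin]
    rw [show r' * (14 * R) = 14 * (r' * R) by ring]
    omega
  · have hs : ∀ k, st k ∈ affSpan (reluFam F) := fun k =>
      nonneg_mem_affSpan F (.inl k) (hst0 k)
    have hbm : ∀ p, bit p ∈ affSpan (reluFam F) := fun p =>
      nonneg_mem_affSpan F (.inr (.inl p)) (hbit0 p)
    have hprod : ∀ p, (fun x => bit p x * t x) ∈ affSpan (reluFam F) := fun p => by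
      convert relu_mem_affSpan F (.inr (.inr p)) using 1
      ext x
      change β p (q x) (b x) (i x) * t x = max 0 (t x + V * β p (q x) (b x) (i x) - V)
      have := ht0 x
      have := ht1 x
      rcases hβ p (q x) (b x) (i x) with h | h <;> rw [h]
      · rw [max_eq_left (by linarith)]
        ring
      · rw [max_eq_right (by linarith)]
        ring
    intro k
    fin_cases k
    · exact hs 0
    · exact hs 1
    · exact hs 2
    · exact hs 3
    · exact add_mem_affSpan (hs 4) (sum_mem_affSpan fun p _ => mul_mem_affSpan _ (hprod p))
    · exact add_mem_affSpan (hs 5) (sum_mem_affSpan fun p _ => mul_mem_affSpan _ (hbm p))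

lemma realizes_rounds {X : Type} {q b i : X → ℕ} {R S : ℕ} (hR : 1 ≤ R)
    (hq : ∀ x, q x < S * R) (hb : ∀ x, b x < R) (hi : ∀ x, i x < S) (r' s' : ℕ)
    (β : ℕ → Fin r' → ℕ → ℕ → ℕ → ℝ) (hβ : ∀ l p q b t, β l p q b t = 0 ∨ β l p q b t = 1)
    (wt : ℕ → Fin r' → ℝ) (hwt : ∀ l p, 0 ≤ wt l p)
    {V : ℝ} {t : X → ℝ} (ht0 : ∀ x, 0 ≤ t x) (ht1 : ∀ x, t x ≤ V) :
    Realizes ![fun x => (q x : ℝ), fun x => (b x : ℝ), fun x => (i x : ℝ), t]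
      (r' * (14 * R) + 6) (s' * (4 * S + 1))
      ![fun x => (q x : ℝ), fun x => (b x : ℝ), fun x => (i x : ℝ), t,
        fun x => (∑ l ∈ Finset.range s', ∑ p, wt l p * β l p (q x) (b x) (i x)) * t x,
        fun x => ∑ l ∈ Finset.range s', ∑ p, wt l p * β l p (q x) (b x) (i x)] := by
  have hterm : ∀ l p q b t, 0 ≤ wt l p * β l p q b t := fun l p q b t => by
    rcases hβ l p q b t with h | h <;> simp [h, hwt]
  induction s' with
  | zero =>
    rw [zero_mul]
    refine .affine fun k => ?_
    have := self_mem_affSpan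
      ![fun x => (q x : ℝ), fun x => (b x : ℝ), fun x => (i x : ℝ), t]
    fin_cases k
    · exact this 0
    · exact this 1
    · exact this 2
    · exact this 3
    · simpa using const_mem_affSpan
        ![fun x => (q x : ℝ), fun x => (b x : ℝ), fun x => (i x : ℝ), t] 0
    · simpa using const_mem_affSpan
        ![fun x => (q x : ℝ), fun x => (b x : ℝ), fun x => (i x : ℝ), t] 0
  | succ n ih =>
    have hsum : ∀ x, 0 ≤ ∑ l ∈ Finset.range n, ∑ p, wt l p * β l p (q x) (b x) (i x) :=
      fun x => Finset.sum_nonneg fun _ _ => Finset.sum_nonneg fun _ _ => hterm _ _ _ _ _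
    have h := ih.trans (realizes_round hR hq hb hi r' (β n) (hβ n) (wt n) ht0 ht1
      (fun x => mul_nonneg (hsum x) (ht0 x)) hsum)
    rw [Nat.succ_mul n]
    have e₁ : (fun x => (∑ l ∈ Finset.range (n + 1),
        ∑ p, wt l p * β l p (q x) (b x) (i x)) * t x) =
        fun x => (∑ l ∈ Finset.range n, ∑ p, wt l p * β l p (q x) (b x) (i x)) * t x +
          ∑ p, wt n p * (β n p (q x) (b x) (i x) * t x) := by
      ext x
      rw [Finset.sum_range_succ, add_mul]
      congr 1
      rw [Finset.sum_mul]
      exact Finset.sum_congr rfl fun p _ => by ring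
    rw [e₁]
    simp only [Finset.sum_range_succ]
    exact h

/-! ### Binary expansion of coefficients and digits of cell indices. -/

lemma exists_bits (T : ℕ) : ∀ u : ℝ, 0 ≤ u → u ≤ 1 → ∃ β : ℕ → ℝ, (∀ l, β l = 0 ∨ β l = 1) ∧
    |u - ∑ l ∈ Finset.range T, (1 / 2) ^ (l + 1) * β l| ≤ (1 / 2) ^ T := by
  induction T with
  | zero =>
    intro u h0 h1
    exact ⟨fun _ => 0, fun _ => .inl rfl, by simpa [abs_of_nonneg h0] using h1⟩
  | succ T ih =>
    intro u h0 h1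
    -- Here `e` is the leading binary digit, and `2 * u - e` is what the remaining digits must
    -- approximate.
    obtain ⟨e, he, h0', h1'⟩ : ∃ e : ℝ, (e = 0 ∨ e = 1) ∧ 0 ≤ 2 * u - e ∧ 2 * u - e ≤ 1 := by
      by_cases h : 1 / 2 ≤ u
      · exact ⟨1, .inr rfl, by linarith, by linarith⟩
      · exact ⟨0, .inl rfl, by linarith, by linarith⟩
    obtain ⟨β, hβ, hle⟩ := ih _ h0' h1'
    refine ⟨fun l => Nat.casesOn l e β, fun l => by cases l; exacts [he, hβ _], ?_⟩
    rw [Finset.sum_range_succ']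
    have : u - (∑ l ∈ Finset.range T, (1 / 2 : ℝ) ^ (l + 1 + 1) * β l + (1 / 2) ^ (0 + 1) * e) =
        1 / 2 * (2 * u - e - ∑ l ∈ Finset.range T, (1 / 2) ^ (l + 1) * β l) := by
      have h2 : ∑ l ∈ Finset.range T, (1 / 2 : ℝ) ^ (l + 1 + 1) * β l =
          1 / 2 * ∑ l ∈ Finset.range T, (1 / 2) ^ (l + 1) * β l := by
        rw [Finset.mul_sum]
        exact Finset.sum_congr rfl fun l _ => by ring
      rw [h2]
      ring
    change |u - (∑ l ∈ Finset.range T, (1 / 2 : ℝ) ^ (l + 1 + 1) * β l +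
      (1 / 2) ^ (0 + 1) * e)| ≤ _
    rw [this, abs_mul, abs_of_pos (by norm_num), pow_succ]
    linarith

lemma sum_range_mul_fin (f : ℕ → ℝ) (s r : ℕ) :
    ∑ l ∈ Finset.range (s * r), f l = ∑ l ∈ Finset.range s, ∑ p : Fin r, f (l * r + p) := by
  induction s with
  | zero => simp
  | succ s ih =>
    rw [Nat.succ_mul, Finset.sum_range_add, ih, Finset.sum_range_succ,
      Fin.sum_univ_eq_sum_range fun a => f (s * r + a)]

lemma exists_coefficient_bits {M c : ℝ} (hM : 0 < M) (hc : |c| ≤ M) (s r : ℕ) :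
    ∃ β : ℕ → Fin r → ℝ, (∀ l p, β l p = 0 ∨ β l p = 1) ∧
      |c - M * (2 * ∑ l ∈ Finset.range s, ∑ p : Fin r, (1 / 2) ^ (l * r + p + 1) * β l p - 1)| ≤
        2 * M * (1 / 2) ^ (s * r) := by
  obtain ⟨h1, h2⟩ := abs_le.1 hc
  obtain ⟨β, hβ, hle⟩ := exists_bits (s * r) ((c / M + 1) / 2)
    (by
      have : -1 ≤ c / M := by rw [le_div_iff₀ hM]; linarith
      linarith)
    (by
      have : c / M ≤ 1 := by rw [div_le_iff₀ hM]; linarith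
      linarith)
  refine ⟨fun l p => β (l * r + p), fun l p => hβ _, ?_⟩
  rw [sum_range_mul_fin] at hle
  set U := ∑ l ∈ Finset.range s, ∑ p : Fin r, (1 / 2 : ℝ) ^ (l * r + p + 1) * β (l * r + p)
  have : c - M * (2 * U - 1) = 2 * M * ((c / M + 1) / 2 - U) := by
    field_simp
    ring
  rw [this, abs_mul, abs_of_pos (by positivity)]
  exact mul_le_mul_of_nonneg_left hle (by positivity)

/-- The number with base-`b` digits `v`. -/
def digitSum {d : ℕ} (b : ℕ) (v : Fin d → ℕ) : ℕ := ∑ i, v i * b ^ (i : ℕ)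

lemma digitSum_lt {d b : ℕ} {v : Fin d → ℕ} (hv : ∀ i, v i < b) : digitSum b v < b ^ d :=
  (finFunctionFinEquiv fun i => (⟨v i, hv i⟩ : Fin b)).2

lemma digitSum_div_mod {d b : ℕ} {v : Fin d → ℕ} (hv : ∀ i, v i < b) (i : Fin d) :
    digitSum b v / b ^ (i : ℕ) % b = v i :=
  congrArg Fin.val (congrFun (finFunctionFinEquiv.symm_apply_apply
    fun i => (⟨v i, hv i⟩ : Fin b)) i)

/-- The index split used by the table lookup. -/
lemma realizes_split {X : Type} {n : X → ℕ} {R S : ℕ} (hR : 0 < R) (hS : 0 < S)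
    (hn : ∀ x, n x < S * R * (S * R)) {d : ℕ} {y : Fin d → X → ℝ} (hy : ∀ i x, 0 ≤ y i x) :
    Realizes (Sum.elim ![fun x => (n x : ℝ)] y) (2 * R + 3 + d) (S + 1)
      (Sum.elim ![fun x => ((n x / (S * R) : ℕ) : ℝ), fun x => ((n x % (S * R) / S : ℕ) : ℝ),
        fun x => ((n x % (S * R) % S : ℕ) : ℝ)] y) := by
  have hQ : 0 < S * R := Nat.mul_pos hS hR
  let nr : X → ℝ := fun x => (n x : ℝ)
  let q : X → ℝ := fun x => ((n x / (S * R) : ℕ) : ℝ)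
  let p : X → ℝ := fun x => ((n x % (S * R) : ℕ) : ℝ)
  let b : X → ℝ := fun x => ((n x % (S * R) / S : ℕ) : ℝ)
  let i : X → ℝ := fun x => ((n x % (S * R) % S : ℕ) : ℝ)
  -- The input is already an integer, so the gap is `η = 1`.
  have h1 := (realizes_floor_div (u := nr) (m := n) one_pos (fun x => le_rfl)
    (fun x => by simp [nr]) R S (S * R) hQ fun x => (Nat.div_lt_of_lt_mul (hn x)).le).with_carry
      (g := y) hy
  have h2 := (realizes_floor_div (u := p) (m := fun x => n x % (S * R)) one_pos (fun x => le_rfl)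
    (fun x => by simp [p]) R 1 S hS fun x => by
      rw [one_mul]
      exact (Nat.div_lt_of_lt_mul (Nat.mod_lt _ hQ)).le).with_carry
      (g := Sum.elim ![q] y) (by
        rintro (k | k) x
        · fin_cases k
          exact Nat.cast_nonneg _
        · exact hy k x)
  have hcard : Fintype.card (Fin 1 ⊕ Fin d) = 1 + d := by simp
  rw [Fintype.card_fin] at h1
  rw [hcard] at h2
  have h3 := (h1.mono (show _ ≤ 2 * R + 3 + d by omega)).trans
    ((h2.mono (show _ ≤ 2 * R + 3 + d by omega)).pre (by
      have hs := self_mem_affSpan (Sum.elim ![nr, q] y)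
      rintro (k | k | k)
      · fin_cases k
        convert sub_mem_affSpan (hs (.inl 0)) (mul_mem_affSpan ((S * R : ℕ) : ℝ) (hs (.inl 1)))
          using 1
        ext x
        change p x = nr x - ((S * R : ℕ) : ℝ) * q x
        rw [eq_sub_iff_add_eq]
        simp only [p, q, nr]
        exact_mod_cast Nat.mod_add_div (n x) (S * R)
      · fin_cases k
        exact hs (.inl 1)
      · exact hs (.inr k)))
  refine h3.post ?_
  have hs := self_mem_affSpan (Sum.elim ![p, b] (Sum.elim ![q] y))
  rintro (k | k)
  · fin_cases k
    · exact hs (.inr (.inl 0))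
    · exact hs (.inl 1)
    · convert sub_mem_affSpan (hs (.inl 0)) (mul_mem_affSpan (S : ℝ) (hs (.inl 1))) using 1
      ext x
      change i x = p x - (S : ℝ) * b x
      rw [eq_sub_iff_add_eq]
      simp only [p, b, i]
      exact_mod_cast Nat.mod_add_div (n x % (S * R)) S
  · exact hs (.inr (.inr k))

/-! ### One coefficient times the shifted network. -/

/-- The coefficient `c m` is selected by the integer part `m` of the input and multiplied by
the value of the network `N` at the shifted fractional part. -/
lemma realizes_coefficient_mul_net {X : Type} {d : ℕ} (hd : 1 ≤ d) {u : Fin d → X → ℝ}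
    {m : X → Fin d → ℕ} {η : ℝ} (hη : 0 < η) (h1 : ∀ i x, (m x i : ℝ) ≤ u i x)
    (h2 : ∀ i x, u i x ≤ m x i + 1 - η) {j r s r' s' : ℕ} (hm : ∀ x i, m x i < 2 ^ j)
    (hr' : 1 ≤ r') (hrs : d * j ≤ 2 * (s + r)) (N : ReLUNet 1 d) {B : ℝ}
    (hB : ∀ y, |N.eval y 0| ≤ B) (k : Fin d → ℝ) {c : (Fin d → ℕ) → ℝ} {M : ℝ} (hM : 0 < M)
    (hc : ∀ v, |c v| ≤ M) {W : ℕ} (hW₁ : 14 * d * r' * 2 ^ r + 8 * d ≤ W)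
    (hW₂ : N.width + 8 * d ≤ W) :
    ∃ c' : (Fin d → ℕ) → ℝ,
      (∀ v, (∀ i, v i < 2 ^ j) → |c v - c' v| ≤ 2 * M * (1 / 2) ^ (s' * r')) ∧
      Realizes u W (2 ^ s + 2 ^ s + (2 ^ s + 1) + N.hiddenDepth + s' * (4 * 2 ^ s + 1))
        ![fun x => c' (m x) * N.eval (fun i => u i x - m x i - k i) 0] := by
  -- Bits are indexed by the single number `ν`, whose base-`2 ^ j` digits recover the cell.
  choose β hβ hβc using fun ν : ℕ =>
    exists_coefficient_bits hM (hc fun i : Fin d => ν / (2 ^ j) ^ (i : ℕ) % 2 ^ j) s' r'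
  let U : ℕ → ℝ := fun ν =>
    ∑ l ∈ Finset.range s', ∑ p : Fin r', (1 / 2) ^ (l * r' + p + 1) * β ν l p
  refine ⟨fun v => M * (2 * U (digitSum (2 ^ j) v) - 1), fun v hv => ?_, ?_⟩
  · have := hβc (digitSum (2 ^ j) v)
    simpa only [digitSum_div_mod hv] using this
  set R := 2 ^ r with hRdef
  set S := 2 ^ s with hSdef
  have hR : 0 < R := by positivity
  have hS : 0 < S := by positivity
  have hQ : 0 < S * R := Nat.mul_pos hS hR
  have hQ2 : 2 ^ (2 * (s + r)) = S * R * (S * R) := by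
    rw [hRdef, hSdef]
    ring
  have hw₁ : d * R ≤ d * r' * R := Nat.mul_le_mul_right _ (Nat.le_mul_of_pos_right _ hr')
  have hw₂ : r' * R ≤ d * r' * R := by
    rw [mul_assoc]
    exact Nat.le_mul_of_pos_left _ hd
  have hw₃ : R ≤ d * R := Nat.le_mul_of_pos_left _ hd
  have hW : 14 * (d * r' * R) + 8 * d ≤ W := by
    rwa [← mul_assoc, ← mul_assoc]
  have hdR : d ≤ d * R := Nat.le_mul_of_pos_right _ hR
  let n : X → ℕ := fun x => digitSum (2 ^ j) (m x)
  have hn : ∀ x, n x < S * R * (S * R) := fun x => by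
    refine (digitSum_lt (hm x)).trans_le ?_
    rw [← hQ2, ← pow_mul]
    exact Nat.pow_le_pow_right two_pos (by rwa [mul_comm])
  have hmj : ∀ x i, m x i < S * R * (S * R) := fun x i => by
    refine (hm x i).trans_le ?_
    rw [← hQ2]
    exact Nat.pow_le_pow_right two_pos ((Nat.le_mul_of_pos_left _ hd).trans hrs)
  let y : Fin d → X → ℝ := fun i x => u i x - m x i
  have hy : ∀ i x, 0 ≤ y i x := fun i x => sub_nonneg.2 (h1 i x)
  have s1 : Realizes u W (S + S) (Sum.elim ![fun x => (n x : ℝ)] y) := by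
    have h := Realizes.par_family fun i : Fin d =>
      (realizes_floor (u := u i) (m := fun x => m x i) hη (h1 i) (h2 i) R S hQ
        fun x => hmj x i).pre (inp' := u) (fun k => by
          fin_cases k
          exact self_mem_affSpan u i)
    refine (h.mono ?_).post ?_
    · rw [Fintype.card_fin, mul_add, mul_left_comm]
      omega
    · set G := fun p : (Σ _ : Fin d, Fin 2) =>
        (![u p.1, fun x => (m x p.1 : ℝ)] : Fin 2 → X → ℝ) p.2 with hG
      have hs := self_mem_affSpan G
      rintro (i | i)
      · fin_cases i
        convert sum_mem_affSpan (s := Finset.univ) fun (i : Fin d) _ =>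
          mul_mem_affSpan ((2 ^ j) ^ (i : ℕ)) (hs ⟨i, 1⟩) using 1
        ext x
        simp only [n, digitSum]
        simp [mul_comm, hG]
      · exact sub_mem_affSpan (hs ⟨i, 0⟩) (hs ⟨i, 1⟩)
  have s2 := (realizes_split hR hS hn hy).mono (show _ ≤ W by omega)
  let q : X → ℕ := fun x => n x / (S * R)
  let b : X → ℕ := fun x => n x % (S * R) / S
  let i : X → ℕ := fun x => n x % (S * R) % S
  let dig : Fin 3 → X → ℝ := ![fun x => (q x : ℝ), fun x => (b x : ℝ), fun x => (i x : ℝ)]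
  let t : X → ℝ := fun x => N.eval (fun i => y i x - k i) 0
  -- Adding `B` makes the network value nonnegative and at most `2 * B`, as the bit product
  -- requires; the final affine combination cancels it.
  have s3 : Realizes (Sum.elim dig y) W N.hiddenDepth
      ![fun x => (q x : ℝ), fun x => (b x : ℝ), fun x => (i x : ℝ), fun x => t x + B] := by
    have h := (N.realizes fun i x => y i x - k i).with_carry (g := dig) (by
      intro l x
      fin_cases l <;> exact Nat.cast_nonneg _)
    rw [Fintype.card_fin] at h
    refine ((h.mono (show _ ≤ W by omega)).pre ?_).post ?_
    · have hs := self_mem_affSpan (Sum.elim dig y)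
      rintro (l | l)
      · exact sub_mem_affSpan (hs (.inr l)) (const_mem_affSpan _ _)
      · exact hs (.inl l)
    · have hs := self_mem_affSpan (Sum.elim
        (fun (l : Fin 1) x => N.eval (fun i => y i x - k i) l) dig)
      intro l
      fin_cases l
      · exact hs (.inr 0)
      · exact hs (.inr 1)
      · exact hs (.inr 2)
      · exact add_mem_affSpan (hs (.inl 0)) (const_mem_affSpan _ _)
  have s4 := (realizes_rounds (q := q) (b := b) (i := i) hR
    (fun x => Nat.div_lt_of_lt_mul (hn x))
    (fun x => Nat.div_lt_of_lt_mul (Nat.mod_lt _ hQ)) (fun x => Nat.mod_lt _ hS) r' s'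
    (fun l p q b t => β (S * R * q + (S * b + t)) l p) (fun l p q b t => hβ _ l p)
    (fun l p => (1 / 2) ^ (l * r' + p + 1)) (fun l p => by positivity)
    (t := fun x => t x + B) (V := 2 * B) (fun x => by linarith [(abs_le.1 (hB fun i =>
      y i x - k i)).1]) (fun x => by linarith [(abs_le.1 (hB fun i => y i x - k i)).2])).mono
    (show _ ≤ W by rw [mul_left_comm]; omega)
  refine (((s1.trans s2).trans s3).trans s4).post fun l => ?_
  fin_cases l
  have hidx : ∀ x, S * R * q x + (S * b x + i x) = n x := fun x => by
    simp only [q, b, i, Nat.div_add_mod]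
  simp only [hidx]
  have hs := self_mem_affSpan ![fun x => (q x : ℝ), fun x => (b x : ℝ), fun x => (i x : ℝ),
    fun x => t x + B, fun x => U (n x) * (t x + B), fun x => U (n x)]
  have := add_mem_affSpan (sub_mem_affSpan (sub_mem_affSpan (mul_mem_affSpan (2 * M) (hs 4))
    (mul_mem_affSpan (2 * M * B) (hs 5))) (mul_mem_affSpan M (hs 3))) (const_mem_affSpan _ (M * B))
  convert this using 1
  ext x
  change M * (2 * U (n x) - 1) * t x = 2 * M * (U (n x) * (t x + B)) - 2 * M * B * U (n x) -
    M * (t x + B) + M * B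
  ring

/-! ### Medians. -/

/-- The middle value of three numbers. -/
noncomputable def mid (a b c : ℝ) : ℝ := a + b + c - max (max a b) c - min (min a b) c

/-- At most one value is bad, so the other two lie in `[v - E, v + E]` and trap the middle one. -/
lemma abs_mid_sub_le {a b c v E : ℝ} (hab : |a - v| ≤ E ∨ |b - v| ≤ E)
    (hac : |a - v| ≤ E ∨ |c - v| ≤ E) (hbc : |b - v| ≤ E ∨ |c - v| ≤ E) :
    |mid a b c - v| ≤ E := by
  simp only [abs_le, mid] at *
  rcases le_total a b with h₁ | h₁ <;> rcases le_total a c with h₂ | h₂ <;>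
    rcases le_total b c with h₃ | h₃ <;>
    simp only [h₁, h₂, h₃, max_eq_left, max_eq_right, min_eq_left, min_eq_right] <;>
    grind

/-- Iterated middle value over a grid of `3 ^ n` numbers. -/
noncomputable def medianTree : (n : ℕ) → ((Fin n → Fin 3) → ℝ) → ℝ
  | 0, a => a Fin.elim0
  | n + 1, a => mid (medianTree n fun t => a (Fin.cons 0 t)) (medianTree n fun t => a (Fin.cons 1 t))
      (medianTree n fun t => a (Fin.cons 2 t))

/-- Fixing a good shift in the first coordinate gives a subtree that is accurate by induction, and
at most one of the three subtrees has a bad first shift. -/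
lemma abs_medianTree_sub_le {n : ℕ} {good : Fin n → Fin 3 → Prop}
    (hgood : ∀ i s t, s ≠ t → good i s ∨ good i t) {a : (Fin n → Fin 3) → ℝ} {v E : ℝ}
    (ha : ∀ t, (∀ i, good i (t i)) → |a t - v| ≤ E) : |medianTree n a - v| ≤ E := by
  induction n with
  | zero => exact ha _ fun i => i.elim0
  | succ n ih =>
    have key : ∀ c, good 0 c → |medianTree n (fun t => a (Fin.cons c t)) - v| ≤ E := fun c hc =>
      ih (good := fun i => good i.succ) (fun i => hgood i.succ) fun t ht => ha _ fun i => by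
        refine Fin.cases ?_ (fun i => ?_) i
        · simpa using hc
        · simpa using ht i
    have h2 : ∀ c e, c ≠ e → |medianTree n (fun t => a (Fin.cons c t)) - v| ≤ E ∨
        |medianTree n (fun t => a (Fin.cons e t)) - v| ≤ E := fun c e hce =>
      (hgood 0 c e hce).imp (key c) (key e)
    exact abs_mid_sub_le (h2 0 1 (by decide)) (h2 0 2 (by decide)) (h2 1 2 (by decide))

/-- The middle value is `a + b - c - max 0 (max a b - c) + max 0 (c - min a b)`, where `max a b` and
`min a b` share the neuron `max 0 (a - b)`. -/
lemma realizes_mid {X : Type} (a b c : X → ℝ) :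
    Realizes ![a, b, c] 7 2 ![fun x => mid (a x) (b x) (c x)] := by
  let F : Fin 7 → X → ℝ := ![fun x => a x - b x, a, fun x => -a x, b, fun x => -b x, c,
    fun x => -c x]
  have hpm : ∀ t : ℝ, max 0 t - max 0 (-t) = t := fun t => by
    rcases le_total 0 t with h | h
    · rw [max_eq_right h, max_eq_left (by linarith)]
      ring
    · rw [max_eq_left h, max_eq_right (by linarith)]
      ring
  have ha : a ∈ affSpan (reluFam F) := by
    convert sub_mem_affSpan (relu_mem_affSpan F 1) (relu_mem_affSpan F 2) using 1
    ext x
    exact (hpm _).symm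
  have hb : b ∈ affSpan (reluFam F) := by
    convert sub_mem_affSpan (relu_mem_affSpan F 3) (relu_mem_affSpan F 4) using 1
    ext x
    exact (hpm _).symm
  have hc : c ∈ affSpan (reluFam F) := by
    convert sub_mem_affSpan (relu_mem_affSpan F 5) (relu_mem_affSpan F 6) using 1
    ext x
    exact (hpm _).symm
  have hr : (fun x => max 0 (a x - b x)) ∈ affSpan (reluFam F) := relu_mem_affSpan F 0
  let G : Fin 4 → X → ℝ := ![fun x => b x + max 0 (a x - b x) - c x,
    fun x => c x - (a x - max 0 (a x - b x)), fun x => a x + b x - c x,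
    fun x => -(a x + b x - c x)]
  have h1 : Realizes ![a, b, c] 7 1 G := by
    refine .single_layer (h := F) ?_ (by simp) ?_
    · have hs := self_mem_affSpan ![a, b, c]
      intro k
      fin_cases k
      exacts [sub_mem_affSpan (hs 0) (hs 1), hs 0, neg_mem_affSpan (hs 0), hs 1,
        neg_mem_affSpan (hs 1), hs 2, neg_mem_affSpan (hs 2)]
    · have hs := sub_mem_affSpan (add_mem_affSpan ha hb) hc
      intro k
      fin_cases k
      exacts [sub_mem_affSpan (add_mem_affSpan hb hr) hc,
        sub_mem_affSpan hc (sub_mem_affSpan ha hr), hs, neg_mem_affSpan hs]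
  refine h1.trans (H' := 1) (.single_layer (h := G) (fun k => self_mem_affSpan G k) (by simp) ?_)
  intro k
  fin_cases k
  have hs := relu_mem_affSpan G
  convert add_mem_affSpan (sub_mem_affSpan (sub_mem_affSpan (hs 2) (hs 3)) (hs 0)) (hs 1) using 1
  ext x
  change mid (a x) (b x) (c x) = max 0 (a x + b x - c x) - max 0 (-(a x + b x - c x)) -
    max 0 (b x + max 0 (a x - b x) - c x) + max 0 (c x - (a x - max 0 (a x - b x)))
  have e1 : b x + max 0 (a x - b x) = max (a x) (b x) := by grind
  have e2 : a x - max 0 (a x - b x) = min (a x) (b x) := by grind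
  rw [hpm, e1, e2, mid]
  grind

lemma realizes_medianTree {X ι : Type} {inp : ι → X → ℝ} {W H : ℕ} (hW : 7 ≤ W) {n : ℕ}
    {a : (Fin n → Fin 3) → X → ℝ} (ha : ∀ t, Realizes inp W H ![a t]) :
    Realizes inp (3 ^ n * W) (H + 2 * n) ![fun x => medianTree n fun t => a t x] := by
  induction n with
  | zero => simpa [medianTree] using ha Fin.elim0
  | succ n ih =>
    have h1 := Realizes.par_family fun c : Fin 3 => ih (a := fun t => a (Fin.cons c t))
      fun t => ha _
    rw [Fintype.card_fin, ← mul_assoc, ← pow_succ'] at h1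
    have h2 : 7 ≤ 3 ^ (n + 1) * W := hW.trans (Nat.le_mul_of_pos_left _ (by positivity))
    refine h1.trans (((realizes_mid _ _ _).mono h2).pre ?_)
    have hs := self_mem_affSpan fun p : (Σ _ : Fin 3, Fin 1) =>
      (![fun x => medianTree n fun t => a (Fin.cons p.1 t) x] : Fin 1 → X → ℝ) p.2
    intro k
    fin_cases k
    exacts [hs ⟨0, 0⟩, hs ⟨1, 0⟩, hs ⟨2, 0⟩]

/-! ### Good shifts of the grid and active shifts of `φ`. -/

/-- If both fractional parts exceeded `1 - η` they would differ by less than `η`, while the points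
differ by `η` or `2 * η`. The integer parts would then differ by an integer strictly between `0` and
`3 * η ≤ 1`. -/
lemma fract_shift_good {η w : ℝ} (hη : η ≤ 1 / 3) (s t : Fin 3) (hst : s ≠ t) :
    Int.fract (w + η * (s : ℕ)) ≤ 1 - η ∨ Int.fract (w + η * (t : ℕ)) ≤ 1 - η := by
  by_contra! hcon
  obtain ⟨h1, h2⟩ := hcon
  wlog h : s < t generalizing s t
  · exact this t s hst.symm h2 h1 (lt_of_le_of_ne (not_lt.1 h) hst.symm)
  have hts : ((t : ℕ) : ℝ) - (s : ℕ) = 1 ∨ ((t : ℕ) : ℝ) - (s : ℕ) = 2 := by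
    fin_cases s <;> fin_cases t <;> simp at h ⊢; norm_num
  have e1 := Int.fract_add_floor (w + η * (s : ℕ))
  have e2 := Int.fract_add_floor (w + η * (t : ℕ))
  have l1 := Int.fract_lt_one (w + η * (s : ℕ))
  have l2 := Int.fract_lt_one (w + η * (t : ℕ))
  set p := ⌊w + η * (s : ℕ)⌋
  set q := ⌊w + η * (t : ℕ)⌋
  have hd : (q : ℝ) - p = η * ((t : ℕ) - (s : ℕ)) + Int.fract (w + η * (s : ℕ)) -
      Int.fract (w + η * (t : ℕ)) := by linarith
  have hpos : (0 : ℝ) < (q : ℝ) - p := by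
    rw [hd]
    rcases hts with h | h <;> rw [h] <;> linarith
  have hlt : (q : ℝ) - p < 1 := by
    rw [hd]
    rcases hts with h | h <;> rw [h] <;> linarith
  have a1 : (0 : ℤ) < q - p := by exact_mod_cast hpos
  have a2 : q - p < (1 : ℤ) := by exact_mod_cast hlt
  omega

lemma abs_le_supNorm {d : ℕ} {φ : (Fin d → ℝ) → ℝ} (hφc : Continuous φ)
    (hφs : HasCompactSupport φ) (x : Fin d → ℝ) : |φ x| ≤ supNorm φ := by
  obtain ⟨C, hC⟩ := hφs.exists_bound_of_continuous hφc
  exact le_ciSup (f := fun x => |φ x|) ⟨C, by rintro _ ⟨y, rfl⟩; exact hC y⟩ x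

lemma activeShifts_finite {d : ℕ} {φ : (Fin d → ℝ) → ℝ} (hφs : HasCompactSupport φ) :
    (activeShifts φ).Finite := by
  obtain ⟨r, hr⟩ := hφs.isCompact.isBounded.subset_closedBall 0
  refine (Set.finite_Icc (fun _ => -⌈r + 1⌉) (fun _ : Fin d => ⌈r + 1⌉)).subset ?_
  rintro n ⟨x, hx, hne⟩
  have hb : ∀ i, |x i - n i| ≤ r := fun i => by
    have h1 := mem_closedBall_zero_iff.1 (hr (subset_tsupport _ hne))
    exact (norm_le_pi_norm (fun i => x i - (n i : ℝ)) i).trans h1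
  have hc := Int.le_ceil (r + 1)
  refine ⟨fun i => ?_, fun i => ?_⟩ <;> have h1 := abs_le.1 (hb i) <;>
    obtain ⟨h2, h3⟩ := hx i <;> rify <;> linarith

/-- Substitute `n = m + k`: as `u - m` lies in the half-open unit cube, a nonzero term forces `k` to
be active. -/
lemma sum_shifts_eq {d : ℕ} {φ : (Fin d → ℝ) → ℝ} (hA : (activeShifts φ).Finite)
    (c : (Fin d → ℤ) →₀ ℝ) {u : Fin d → ℝ} {m : Fin d → ℤ}
    (hu : ∀ i, u i - m i ∈ Set.Ico (0 : ℝ) 1) :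
    (c.sum fun n a => a * φ fun i => u i - (n i : ℝ)) =
      ∑ k ∈ hA.toFinset, c (fun i => m i + k i) * φ fun i => u i - m i - (k i : ℝ) := by
  classical
  let f : (Fin d → ℤ) → ℝ := fun n => c n * φ fun i => u i - (n i : ℝ)
  have h1 : ∑ k ∈ hA.toFinset, c (fun i => m i + k i) * φ (fun i => u i - m i - (k i : ℝ)) =
      ∑ n ∈ hA.toFinset.map (addLeftEmbedding m), f n := by
    rw [Finset.sum_map]
    refine Finset.sum_congr rfl fun k _ => ?_
    simp only [f, addLeftEmbedding_apply, Pi.add_apply, Int.cast_add, sub_sub]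
    rfl
  rw [h1]
  change ∑ n ∈ c.support, f n = _
  rw [Finset.sum_subset (Finset.subset_union_left (s₂ := hA.toFinset.map (addLeftEmbedding m))),
    ← Finset.sum_subset (Finset.subset_union_right (s₁ := c.support))]
  · intro n _ hn
    by_contra hne
    refine hn (Finset.mem_map.2 ⟨n - m, hA.mem_toFinset.2 ⟨fun i => u i - m i, hu, ?_⟩, by simp⟩)
    have := right_ne_zero_of_mul hne
    convert this using 3
    rw [Pi.sub_apply, Int.cast_sub]
    ring
  · intro n _ hn
    simp only [f, Finsupp.notMem_support_iff.1 hn, zero_mul]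

lemma eq_zero_of_activeShifts_eq_empty {d : ℕ} {φ : (Fin d → ℝ) → ℝ} (h : activeShifts φ = ∅)
    (x : Fin d → ℝ) : φ x = 0 := by
  by_contra hne
  have : (fun i => -⌊x i⌋) ∈ activeShifts φ :=
    ⟨fun i => Int.fract (x i), fun i => ⟨Int.fract_nonneg _, Int.fract_lt_one _⟩, by
      simpa only [Int.cast_neg, sub_neg_eq_add, Int.fract_add_floor] using hne⟩
  simp [h] at this

lemma two_mul_half_pow_le {ε : ℝ} (hε : 0 < ε) {T : ℕ}
    (hT : ⌈Real.logb 2 (1 / ε)⌉ + 1 ≤ (T : ℤ)) : 2 * (1 / 2 : ℝ) ^ T ≤ ε := by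
  have h1 : Real.logb 2 (1 / ε) ≤ T - 1 := by
    refine (Int.le_ceil _).trans ?_
    have : ((⌈Real.logb 2 (1 / ε)⌉ + 1 : ℤ) : ℝ) ≤ T := by exact_mod_cast hT
    push_cast at this
    linarith
  rw [Real.logb_le_iff_le_rpow one_lt_two (by positivity), Real.rpow_sub_one two_ne_zero,
    Real.rpow_natCast, div_le_div_iff₀ hε two_pos] at h1
  rw [one_div, inv_pow, ← div_eq_mul_inv, div_le_iff₀ (by positivity)]
  linarith

/-! ### Assembly and the final error estimate. -/

/-- Approximation away from the discontinuities of `x ↦ ⌊2 ^ j * x⌋`. -/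
lemma exists_net_off_grid {d j : ℕ} (hd : 1 ≤ d) {ε : ℝ} (hε0 : 0 < ε) (hε1 : ε < 1)
    {φ : (Fin d → ℝ) → ℝ} (hφc : Continuous φ) (hφs : HasCompactSupport φ) (N : ReLUNet 1 d)
    (hN : ∀ x, |φ x - N.eval x 0| ≤ ε * supNorm φ) {M : ℝ} (hM : 0 < M)
    {c : (Fin d → ℤ) →₀ ℝ} (hc : ∀ n, |c n| < M) {r s r' s' : ℕ} (hr' : 1 ≤ r')
    (hrs : d * j ≤ 2 * (s + r))
    (hrs' : ⌈Real.logb 2 (1 / ε)⌉ + 1 ≤ ((s' * r' : ℕ) : ℤ)) {η : ℝ} (hη : 0 < η) {W : ℕ}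
    (hW₁ : 14 * d * r' * 2 ^ r + 8 * d ≤ W) (hW₂ : N.width + 8 * d ≤ W) :
    ∃ F : ReLUNet 1 d, F.depth =
        2 ^ s + 2 ^ s + (2 ^ s + 1) + N.hiddenDepth + s' * (4 * 2 ^ s + 1) + 1 ∧
      F.width ≤ activeShiftCount φ * W ∧
      ∀ x : Fin d → ℝ, (∀ i, 0 ≤ x i ∧ x i < 1 ∧ Int.fract (2 ^ j * x i) ≤ 1 - η) →
        |(c.sum fun n a => a * φ fun i => 2 ^ j * x i - (n i : ℝ)) - F.eval x 0| ≤
          3 * activeShiftCount φ * M * supNorm φ * ε := by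
  have hA := activeShifts_finite hφs
  let X : Type := {x : Fin d → ℝ // ∀ i, 0 ≤ x i ∧ x i < 1 ∧ Int.fract (2 ^ j * x i) ≤ 1 - η}
  let inp : Fin d → X → ℝ := fun i x => x.1 i
  let u : Fin d → X → ℝ := fun i x => 2 ^ j * x.1 i
  let m : X → Fin d → ℕ := fun x i => ⌊u i x⌋₊
  have hu0 : ∀ i x, 0 ≤ u i x := fun i x => mul_nonneg (by positivity) (x.2 i).1
  have hfr : ∀ i x, u i x - m x i = Int.fract (u i x) := fun i x => by
    rw [Int.fract, natCast_floor_eq_intCast_floor (hu0 i x)]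
  have hsup : 0 ≤ supNorm φ := (abs_nonneg _).trans (abs_le_supNorm hφc hφs 0)
  have hB : ∀ y, |N.eval y 0| ≤ 2 * supNorm φ := fun y => by
    have e1 := abs_le.1 (hN y)
    have e2 := abs_le.1 (abs_le_supNorm hφc hφs y)
    have e3 : ε * supNorm φ ≤ supNorm φ := mul_le_of_le_one_left hsup hε1.le
    exact abs_le.2 ⟨by linarith, by linarith⟩
  choose c' hc' hreal using fun k : hA.toFinset =>
    realizes_coefficient_mul_net hd (u := u) (m := m) hη (fun i x => Nat.floor_le (hu0 i x))
      (fun i x => by linarith [hfr i x, (x.2 i).2.2]) (j := j) (s' := s') (fun x i => by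
        rw [Nat.floor_lt (hu0 i x)]
        have := (x.2 i).2.1
        push_cast
        exact mul_lt_of_lt_one_right (by positivity) this) hr' hrs N hB
      (fun i => (k.1 i : ℝ)) (c := fun v => c fun i => (v i : ℤ) + k.1 i) hM
      (fun v => (hc _).le) hW₁ hW₂
  have hcard : Fintype.card hA.toFinset = activeShiftCount φ := by
    rw [Fintype.card_coe, activeShiftCount, Set.ncard_eq_toFinset_card _ hA]
  have h1 := ((Realizes.par_family hreal).pre (inp' := inp) fun i =>
    mul_mem_affSpan _ (self_mem_affSpan inp i)).post
      (g := ![fun x => ∑ k, c' k (m x) * N.eval (fun i => u i x - m x i - (k.1 i : ℝ)) 0]) (by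
    set G := fun p : (Σ _ : hA.toFinset, Fin 1) => (![fun x => c' p.1 (m x) *
      N.eval (fun i => u i x - m x i - (p.1.1 i : ℝ)) 0] : Fin 1 → X → ℝ) p.2
    intro l
    fin_cases l
    exact sum_mem_affSpan fun k _ => self_mem_affSpan G ⟨k, 0⟩)
  rw [hcard] at h1
  obtain ⟨F, hF1, hF2, hF3⟩ := h1.exists_scalar_net
  refine ⟨F, hF1, hF2, fun x hx => ?_⟩
  have hFx := hF3 ⟨x, hx⟩
  change F.eval x 0 = _ at hFx
  rw [hFx]
  set z : X := ⟨x, hx⟩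
  rw [sum_shifts_eq hA c (u := fun i => u i z) (m := fun i => (m z i : ℤ)) (fun i => by
    rw [Int.cast_natCast, hfr]
    exact ⟨Int.fract_nonneg _, Int.fract_lt_one _⟩), ← Finset.sum_coe_sort hA.toFinset,
    ← Finset.sum_sub_distrib]
  refine (Finset.abs_sum_le_sum_abs _ _).trans ((Finset.sum_le_card_nsmul _ _
    (3 * M * supNorm φ * ε) fun k _ => ?_).trans_eq ?_)
  · simp only [Int.cast_natCast]
    set y : Fin d → ℝ := fun i => u i z - m z i - (k.1 i : ℝ)
    set a := c fun i => (m z i : ℤ) + k.1 i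
    have e1 : |a - c' k (m z)| ≤ M * ε := by
      refine (hc' k (m z) fun i => ?_).trans ?_
      · rw [Nat.floor_lt (hu0 i z)]
        push_cast
        exact mul_lt_of_lt_one_right (by positivity) (hx i).2.1
      · rw [mul_right_comm, mul_comm _ M]
        exact mul_le_mul_of_nonneg_left (two_mul_half_pow_le hε0 hrs') hM.le
    -- The first product costs `M * ε * supNorm φ`, the second twice that because the network is
    -- bounded by `2 * supNorm φ`; hence the factor `3`.
    have e2 : a * φ y - c' k (m z) * N.eval y 0 =
        a * (φ y - N.eval y 0) + (a - c' k (m z)) * N.eval y 0 := by ring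
    rw [e2]
    refine (abs_add_le _ _).trans ?_
    rw [abs_mul, abs_mul]
    have e3 : |a| * |φ y - N.eval y 0| ≤ M * (ε * supNorm φ) :=
      mul_le_mul (hc _).le (hN y) (abs_nonneg _) hM.le
    have e4 : |a - c' k (m z)| * |N.eval y 0| ≤ M * ε * (2 * supNorm φ) :=
      mul_le_mul e1 (hB y) (abs_nonneg _) (by positivity)
    linarith
  · rw [Finset.card_univ, hcard, nsmul_eq_mul]
    ring

theorem mainTheorem1 (d j : ℕ) (hd : 1 ≤ d) (hj : 1 ≤ j) (ε : ℝ) (hε0 : 0 < ε) (hε1 : ε < 1)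
    (φ : (Fin d → ℝ) → ℝ) (hφc : Continuous φ) (hφs : HasCompactSupport φ)
    (Nφ Lφ : ℕ)
    (happrox : ∃ φ₀ ∈ ReLUClass d Nφ Lφ, ∀ x, |φ x - φ₀ x| ≤ ε * supNorm φ)
    (M : ℝ) (hM : 0 < M)
    (g : (Fin d → ℝ) → ℝ) (hg : g ∈ dilatedShiftSpace φ j M)
    (r s r' s' : ℕ) (hr : 1 ≤ r) (hs : 1 ≤ s) (hr' : 1 ≤ r') (hs' : 1 ≤ s')
    (hrs : d * j ≤ 2 * (s + r))
    (hrs' : ⌈Real.logb 2 (1 / ε)⌉ + 1 ≤ (r' : ℤ) * (s' : ℤ)) :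
    ∃ Φ ∈ ReLUClass d
        (3 ^ d * (2 * activeShiftCount φ * (max (7 * d * r' * 2 ^ r) Nφ + 4 * d)))
        (14 * s' * 2 ^ s + Lφ + 2 * d),
      ∀ x : Fin d → ℝ, (∀ i, x i ∈ Set.Icc (0 : ℝ) 1) →
        |g x - Φ x| ≤ 6 * (activeShiftCount φ : ℝ) * M * supNorm φ * ε := by
  have hA := activeShifts_finite hφs
  obtain ⟨φ₀, ⟨N, hN2, hNL, hNW, hNe⟩, hNa⟩ := happrox
  obtain ⟨c, hc, hgc⟩ := hg
  have hsup : 0 ≤ supNorm φ := (abs_nonneg _).trans (abs_le_supNorm hφc hφs 0)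
  rcases (activeShifts φ).eq_empty_or_nonempty with hemp | hne
  -- The width bound is `0` here, so only an empty hidden layer, that is, a constant, is allowed.
  · have hφ0 := eq_zero_of_activeShifts_eq_empty hemp
    refine ⟨fun _ => 0, ⟨.hidden (k := 0) 0 0 (.output 0 0), ?_, ?_, ?_, ?_⟩, fun x _ => ?_⟩
    · simp [ReLUNet.depth]
    · simp only [ReLUNet.depth]
      omega
    · simp [ReLUNet.width]
    · simp [ReLUNet.eval]
    · simp only [hgc, hφ0, mul_zero, Finsupp.sum_fun_zero, sub_zero, abs_zero]
      positivity
  have hC : 0 < activeShiftCount φ := (Set.ncard_pos hA).2 hne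
  have hsup0 : 0 < supNorm φ := by
    obtain ⟨n, x, _, hx⟩ := hne
    exact (abs_pos.2 hx).trans_le (abs_le_supNorm hφc hφs _)
  set C := activeShiftCount φ
  set E : ℝ := 3 * C * M * supNorm φ * ε with hE
  have hE0 : 0 < E := by positivity
  have hgcont : Continuous g := by
    rw [funext hgc]
    unfold Finsupp.sum
    fun_prop
  obtain ⟨δ₀, hδ₀, hunif⟩ := Metric.uniformContinuousOn_iff.1
    ((isCompact_Icc (a := (0 : Fin d → ℝ)) (b := 1)).uniformContinuousOn_of_continuous
      hgcont.continuousOn) E hE0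
  -- Displacements will be at most `3 * δ`, and the grid variable `2 ^ j * x` moves in steps `2 ^ j
  -- * δ`, which must not exceed `1 / 3`.
  obtain ⟨δ, hδ, hδ1, hδ2⟩ : ∃ δ : ℝ, 0 < δ ∧ 3 * δ < δ₀ ∧ 2 ^ j * δ ≤ 1 / 3 := by
    refine ⟨min (δ₀ / 4) (1 / 3 / 2 ^ j), by positivity, ?_, ?_⟩
    · have := min_le_left (δ₀ / 4) (1 / 3 / 2 ^ j)
      linarith
    · have := min_le_right (δ₀ / 4) (1 / 3 / 2 ^ j)
      rwa [le_div_iff₀' (by positivity)] at this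
  have hδ3 : 3 * δ ≤ 1 := by
    have : δ ≤ 2 ^ j * δ := le_mul_of_one_le_left hδ.le (one_le_pow₀ one_le_two)
    linarith
  set W : ℕ := 2 * max (7 * d * r' * 2 ^ r) Nφ + 8 * d with hW
  have hW₁ : 14 * d * r' * 2 ^ r + 8 * d ≤ W := by
    have := le_max_left (7 * d * r' * 2 ^ r) Nφ
    rw [hW, show 14 * d * r' * 2 ^ r = 2 * (7 * d * r' * 2 ^ r) by ring]
    omega
  have hW₂ : N.width + 8 * d ≤ W := by
    have := le_max_right (7 * d * r' * 2 ^ r) Nφ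
    omega
  obtain ⟨F, hF1, hF2, hF3⟩ := exists_net_off_grid hd hε0 hε1 hφc hφs N
    (fun x => by rw [← hNe]; exact hNa x) hM hc hr' hrs
    (by rw [mul_comm s' r']; push_cast; exact hrs') (mul_pos (pow_pos two_pos j) hδ) hW₁ hW₂
  simp only [← hgc] at hF3
  -- Contracting by `1 - 3 * δ` before shifting by at most `2 * δ` keeps every sample point in `[0,
  -- 1)`, even when a coordinate of `x` is `1`.
  let p : (Fin d → Fin 3) → Fin d → (Fin d → ℝ) → ℝ :=
    fun t i x => (1 - 3 * δ) * x i + δ * ((t i : ℕ) : ℝ)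
  let inp : Fin d → (Fin d → ℝ) → ℝ := fun i x => x i
  have hreal : ∀ t, Realizes inp (C * W) F.hiddenDepth
      ![fun x => F.eval (fun i => p t i x) 0] := fun t =>
    (((F.realizes (p t)).mono hF2).pre fun i => add_mem_affSpan
      (mul_mem_affSpan _ (self_mem_affSpan inp i)) (const_mem_affSpan _ _)).post fun k => by
        fin_cases k
        exact self_mem_affSpan (fun i x => F.eval (fun k => p t k x) i) 0
  have h7 : 7 ≤ C * W := by
    have : W ≤ C * W := Nat.le_mul_of_pos_left _ hC
    omega
  obtain ⟨G, hG1, hG2, hG3⟩ := (realizes_medianTree h7 hreal).exists_scalar_net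
  refine ⟨fun x => G.eval x 0, ⟨G, ?_, ?_, ?_, fun _ => rfl⟩, fun x hx => ?_⟩
  · omega
  · have e1 := F.depth_eq
    have e2 := N.depth_eq
    have e3 : s' ≤ s' * 2 ^ s := Nat.le_mul_of_pos_right _ (by positivity)
    have e4 : 2 ^ s ≤ s' * 2 ^ s := Nat.le_mul_of_pos_left _ hs'
    have e5 : s' * (4 * 2 ^ s + 1) = 4 * (s' * 2 ^ s) + s' := by ring
    rw [mul_assoc]
    omega
  · refine hG2.trans_eq ?_
    rw [hW]
    ring
  · have hx0 : x ∈ Set.Icc (0 : Fin d → ℝ) 1 := ⟨fun i => (hx i).1, fun i => (hx i).2⟩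
    rw [abs_sub_comm]
    change |G.eval (fun i => inp i x) 0 - g x| ≤ _
    rw [hG3]
    refine abs_medianTree_sub_le
      (good := fun i t => Int.fract (2 ^ j * ((1 - 3 * δ) * x i) + 2 ^ j * δ * ((t : ℕ) : ℝ)) ≤
        1 - 2 ^ j * δ)
      (fun i s t hst => fract_shift_good hδ2 s t hst) fun t ht => ?_
    have ht2 : ∀ i, ((t i : ℕ) : ℝ) ≤ 2 := fun i => by
      exact_mod_cast Nat.lt_succ_iff.1 (t i).2
    have ht0 : ∀ i, (0 : ℝ) ≤ ((t i : ℕ) : ℝ) := fun i => Nat.cast_nonneg _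
    set x' : Fin d → ℝ := fun i => p t i x with hx'
    have hlow : ∀ i, 0 ≤ x' i := fun i =>
      add_nonneg (mul_nonneg (by linarith) (hx i).1) (mul_nonneg hδ.le (ht0 i))
    have hup : ∀ i, x' i < 1 := fun i => by
      have e1 : (1 - 3 * δ) * x i ≤ 1 - 3 * δ := mul_le_of_le_one_right (by linarith) (hx i).2
      have e2 : δ * ((t i : ℕ) : ℝ) ≤ δ * 2 := mul_le_mul_of_nonneg_left (ht2 i) hδ.le
      simp only [hx', p]
      linarith
    have h1 := hF3 x' fun i => ⟨hlow i, hup i, by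
      have := ht i
      rwa [show 2 ^ j * ((1 - 3 * δ) * x i) + 2 ^ j * δ * ((t i : ℕ) : ℝ) = 2 ^ j * x' i by
        simp only [hx', p]
        ring] at this⟩
    have h2 : |g x' - g x| < E := by
      refine hunif x' ⟨hlow, fun i => (hup i).le⟩ x hx0 ?_
      refine lt_of_le_of_lt ((dist_pi_le_iff (by positivity)).2 fun i => ?_) hδ1
      rw [Real.dist_eq, show x' i - x i = δ * (((t i : ℕ) : ℝ) - 3 * x i) by
        simp only [hx', p]
        ring, abs_mul, abs_of_pos hδ, mul_comm]
      refine mul_le_mul_of_nonneg_right (abs_le.2 ⟨?_, ?_⟩) hδ.le <;>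
        linarith [ht0 i, ht2 i, (hx i).1, (hx i).2]
    rw [abs_sub_comm] at h1
    have h3 := abs_add_le (F.eval x' 0 - g x') (g x' - g x)
    rw [sub_add_sub_cancel] at h3
    change |F.eval x' 0 - g x| ≤ _
    linarith
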